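/- Let $m,n$ be integers with $1\le m\le n$. For $f\in L^2(\mathbb{R}^n)$ let $\widehat f(\xi)=(2\pi)^{-n/2}\int e^{-ix\cdot\xi}f(x)\,dx$ be its Fourier transform (in the sense of Plancherel) and, when $\widehat f$ has compact support, $$e^{it\Delta}f(x)=(2\pi)^{-n/2}\int_{\mathbb{R}^n} e^{i(x\cdot\xi+t|\xi|^2)}\,\widehat f(\xi)\,d\xi .$$ There is a constant $C\ge 1$, depending only on $m$ and $n$, such that for every $R>1$ there exist a nonzero $f\in L^2(\mathbb{R}^n)$ with $\widehat f$ supported in the annulus $\{\xi\in\mathbb{R}^n: C^{-1}R\le|\xi|\le CR\}$ and a measurable set $E\subset B^n(0,1)$ with $$C^{-1}R^{-\frac{n-m}{2}}\le |E|\le C\,R^{-\frac{n-m}{2}}$$ such that for every $x=(x_1,\dots,x_n)\in E$ there is some $t\in\mathbb{R}$ with $$\Bigl|t+\frac{x_1}{2R}\Bigr|\le C R^{-3/2}\qquad\text{and}\qquad \frac{|e^{it\Delta}f(x)|}{\|f\|_{L^2}}\ \ge\ C^{-1}R^{\frac{m}{2(m+1)}}R^{\frac{n-m}{4}} .$$ 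-/

import Mathlib

open MeasureTheory
open scoped FourierTransform

noncomputable section

/-- The unitary Fourier transform
`f̂(ξ) = (2π)^{-n/2} ∫ e^{-i x·ξ} f(x) dx` of `f ∈ L²(ℝⁿ)`, in the sense of Plancherel.
Mathlib's `𝓕` on `L²` has the kernel `e^{-2πi x·ξ}`, whence the rescaling by `2π`. -/
def unitaryFourier {n : ℕ} (f : Lp (α := EuclideanSpace ℝ (Fin n)) ℂ 2 volume)
    (ξ : EuclideanSpace ℝ (Fin n)) : ℂ :=
  (((2 * Real.pi) ^ (-(n : ℝ) / 2) : ℝ) : ℂ) *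
    ((𝓕 f : Lp (α := EuclideanSpace ℝ (Fin n)) ℂ 2 volume) : EuclideanSpace ℝ (Fin n) → ℂ)
      ((2 * Real.pi)⁻¹ • ξ)

/-- `e^{itΔ} f(x) = (2π)^{-n/2} ∫ e^{i (x·ξ + t|ξ|²)} f̂(ξ) dξ`. The integral converges absolutely
at every point when `f̂` has compact support, since then `f̂ ∈ L¹`. -/
def schrodinger {n : ℕ} (t : ℝ) (f : Lp (α := EuclideanSpace ℝ (Fin n)) ℂ 2 volume)
    (x : EuclideanSpace ℝ (Fin n)) : ℂ :=
  (((2 * Real.pi) ^ (-(n : ℝ) / 2) : ℝ) : ℂ) *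
    ∫ ξ : EuclideanSpace ℝ (Fin n),
      Complex.exp (Complex.I * ((inner ℝ x ξ + t * ‖ξ‖ ^ 2 : ℝ) : ℂ)) * unitaryFourier f ξ

end

/-!
The datum is a tensor product, so that its evolution factors into one-dimensional evolutions. Put
`W = √R`. The Fourier transform of the first factor is the indicator of `(W², W² + W]`: its
evolution is a wave packet travelling along `x₁ + 2 R t = 0`, which fixes the time to within
`W⁻³` of `-x₁ / (2R)`. The last `n - m` factors have Fourier transform `1_{(0, W]}` and are of
full size where `0 ≤ x_j ≲ 1 / W`, which is what makes the measure of `E` small. The Fourier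
transform of each of the remaining `m - 1` factors is a comb of unit intervals. At a time close to
a rational multiple `a / q` of its period, and a point close to a multiple of its spatial period
with the same denominator, the sum over the teeth of the comb is a string of complete quadratic
Gauss sums, of relative size `q^{-1/2}`.

The set `E` collects these points for `q ≤ Q = P ^ (m - 1)`. By Dirichlet's theorem on simultaneous
approximation, the boxes of radius `1 / (q P)` around the rational points of denominator `q ≤ Q`
cover the unit cube in `m - 1` dimensions; this survives, up to a factor, when `q` is required to be
comparable to `Q` with `φ(q)` comparable to `q`, since `∑_{p ∣ q} 1 / p` is bounded on average. Each
such `q` allows a positive proportion of first coordinates.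
-/

theorem norm_toLp_two_sq {α E : Type*} [MeasurableSpace α] {μ : Measure α}
    [NormedAddCommGroup E] {F : α → E} (hF : MemLp F 2 μ) :
    ‖hF.toLp F‖ ^ 2 = ∫ x, ‖F x‖ ^ 2 ∂μ := by
  rw [Lp.norm_toLp, hF.eLpNorm_eq_integral_rpow_norm two_ne_zero ENNReal.ofNat_ne_top,
    ENNReal.toReal_ofReal (by positivity), ENNReal.toReal_ofNat, ← Real.rpow_natCast,
    ← Real.rpow_mul (by positivity)]
  simp

theorem memLp_two_comp_smul {E F : Type*} [NormedAddCommGroup E] [NormedSpace ℝ E]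
    [FiniteDimensional ℝ E] [MeasurableSpace E] [BorelSpace E] {μ : Measure E} [μ.IsAddHaarMeasure]
    [NormedAddCommGroup F] {f : E → F} (hf : MemLp f 2 μ) {r : ℝ} (hr : r ≠ 0) :
    MemLp (fun x => f (r • x)) 2 μ :=
  (memLp_two_iff_integrable_sq_norm (hf.aestronglyMeasurable.comp_quasiMeasurePreserving
    (Measure.quasiMeasurePreserving_smul μ hr))).2
    (((memLp_two_iff_integrable_sq_norm hf.aestronglyMeasurable).1 hf).comp_smul hr)

theorem exists_unitaryFourier_ae_eq {n : ℕ} {F : EuclideanSpace ℝ (Fin n) → ℂ}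
    (hF : MemLp F 2 volume) :
    ∃ f : Lp (α := EuclideanSpace ℝ (Fin n)) ℂ 2 volume,
      unitaryFourier f =ᵐ[volume] F ∧ ‖f‖ ^ 2 = ∫ ξ, ‖F ξ‖ ^ 2 := by
  have hpi : (0 : ℝ) < 2 * Real.pi := Real.two_pi_pos
  set A : ℝ := (2 * Real.pi) ^ ((n : ℝ) / 2) with hA
  have hA_sq : A ^ 2 = (2 * Real.pi) ^ n := by
    rw [hA, ← Real.rpow_mul_natCast hpi.le, Nat.cast_ofNat, div_mul_cancel₀ _ two_ne_zero,
      Real.rpow_natCast]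
  have hG : MemLp (fun u => (A : ℂ) * F ((2 * Real.pi) • u)) 2 volume :=
    (memLp_two_comp_smul hF hpi.ne').const_mul _
  refine ⟨𝓕⁻ (hG.toLp _), ?_, ?_⟩
  · filter_upwards [(Measure.quasiMeasurePreserving_smul volume (inv_ne_zero hpi.ne')).ae_eq_comp
      hG.coeFn_toLp] with ξ hξ
    rw [Function.comp_apply, Function.comp_apply, smul_inv_smul₀ hpi.ne'] at hξ
    rw [unitaryFourier, FourierTransform.fourier_fourierInv_eq, hξ, ← mul_assoc,
      ← Complex.ofReal_mul, hA, ← Real.rpow_add hpi, neg_div, neg_add_cancel, Real.rpow_zero,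
      Complex.ofReal_one, one_mul]
  · rw [← Lp.norm_fourier_eq, FourierTransform.fourier_fourierInv_eq, norm_toLp_two_sq]
    simp only [norm_mul, Complex.norm_real, mul_pow, Real.norm_eq_abs, sq_abs]
    rw [integral_const_mul, Measure.integral_comp_smul volume (fun ξ => ‖F ξ‖ ^ 2), hA_sq,
      finrank_euclideanSpace_fin, smul_eq_mul, abs_of_pos (by positivity),
      mul_inv_cancel_left₀ (by positivity)]

section Tensor

variable {n : ℕ}

theorem integral_euclideanSpace_prod {𝕜 : Type*} [RCLike 𝕜] (g : Fin n → ℝ → 𝕜) :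
    ∫ ξ : EuclideanSpace ℝ (Fin n), ∏ j, g j (ξ j) = ∏ j, ∫ s, g j s := by
  rw [← integral_fintype_prod_volume_eq_prod (fun j => g j),
    ← (PiLp.volume_preserving_ofLp (Fin n)).integral_comp
      (MeasurableEquiv.toLp 2 (Fin n → ℝ)).symm.measurableEmbedding]

theorem memLp_two_tensor {F : Fin n → ℝ → ℂ} (hF : ∀ j, MemLp (F j) 2 volume) :
    MemLp (fun ξ : EuclideanSpace ℝ (Fin n) => ∏ j, F j (ξ j)) 2 volume := by
  suffices MemLp (fun y : Fin n → ℝ => ∏ j, F j (y j)) 2 volume from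
    this.comp_measurePreserving (PiLp.volume_preserving_ofLp (Fin n))
  have hmeas : AEStronglyMeasurable (fun y : Fin n → ℝ => ∏ j, F j (y j)) volume :=
    Finset.aestronglyMeasurable_fun_prod _ fun j _ =>
      (hF j).aestronglyMeasurable.comp_quasiMeasurePreserving
        (Measure.quasiMeasurePreserving_eval (μ := fun _ : Fin n => (volume : Measure ℝ)) j)
  rw [memLp_two_iff_integrable_sq_norm hmeas]
  simp only [norm_prod, ← Finset.prod_pow]
  exact Integrable.fintype_prod (f := fun j s => ‖F j s‖ ^ 2) fun j =>
    (memLp_two_iff_integrable_sq_norm (hF j).aestronglyMeasurable).1 (hF j)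

/-- The Schrödinger evolution on `ℝ`, without the factor `(2π)^{-1/2}`, of the datum whose
Fourier transform is `F`. -/
noncomputable def evolution (F : ℝ → ℂ) (t x : ℝ) : ℂ :=
  ∫ s, (Circle.exp (x * s + t * s ^ 2) : ℂ) * F s

theorem schrodinger_eq_prod_evolution {F : Fin n → ℝ → ℂ}
    {f : Lp (α := EuclideanSpace ℝ (Fin n)) ℂ 2 volume}
    (hf : unitaryFourier f =ᵐ[volume] fun ξ => ∏ j, F j (ξ j)) (t : ℝ)
    (x : EuclideanSpace ℝ (Fin n)) :
    schrodinger t f x =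
      (((2 * Real.pi) ^ (-(n : ℝ) / 2) : ℝ) : ℂ) * ∏ j, evolution (F j) t (x j) := by
  simp only [schrodinger, evolution]
  rw [← integral_euclideanSpace_prod]
  congr 1
  refine integral_congr_ae ?_
  filter_upwards [hf] with ξ hξ
  have hphase : inner ℝ x ξ + t * ‖ξ‖ ^ 2 = ∑ j, (x j * ξ j + t * ξ j ^ 2) := by
    rw [Finset.sum_add_distrib, ← Finset.mul_sum, EuclideanSpace.real_norm_sq_eq,
      PiLp.inner_apply]
    simp [mul_comm]
  rw [hξ, Finset.prod_mul_distrib, hphase]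
  simp only [Circle.coe_exp]
  rw [← Complex.exp_sum, ← Finset.sum_mul, ← Complex.ofReal_sum, mul_comm Complex.I]

theorem exists_tensor_datum {F : Fin n → ℝ → ℂ} (hF : ∀ j, MemLp (F j) 2 volume) :
    ∃ f : Lp (α := EuclideanSpace ℝ (Fin n)) ℂ 2 volume,
      (unitaryFourier f =ᵐ[volume] fun ξ => ∏ j, F j (ξ j)) ∧
      ‖f‖ = ∏ j, √(∫ s, ‖F j s‖ ^ 2) := by
  obtain ⟨f, hf, hnorm⟩ := exists_unitaryFourier_ae_eq (memLp_two_tensor hF)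
  refine ⟨f, hf, ?_⟩
  simp only [norm_prod, ← Finset.prod_pow] at hnorm
  rw [integral_euclideanSpace_prod fun j s => ‖F j s‖ ^ 2] at hnorm
  rw [← Real.sqrt_sq (norm_nonneg f), hnorm,
    Real.sqrt_prod _ fun j _ => integral_nonneg fun s => sq_nonneg _]

theorem mul_prod_le_norm_schrodinger_div_norm {F : Fin n → ℝ → ℂ}
    {f : Lp (α := EuclideanSpace ℝ (Fin n)) ℂ 2 volume}
    (hf : unitaryFourier f =ᵐ[volume] fun ξ => ∏ j, F j (ξ j))
    (hnorm : ‖f‖ = ∏ j, √(∫ s, ‖F j s‖ ^ 2)) (hF : ∀ j, 0 < ∫ s, ‖F j s‖ ^ 2)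
    {t : ℝ} {x : EuclideanSpace ℝ (Fin n)} {r : Fin n → ℝ} (hr : ∀ j, 0 ≤ r j)
    (hrF : ∀ j, r j * √(∫ s, ‖F j s‖ ^ 2) ≤ ‖evolution (F j) t (x j)‖) :
    (2 * Real.pi) ^ (-(n : ℝ) / 2) * ∏ j, r j ≤ ‖schrodinger t f x‖ / ‖f‖ := by
  have hpos : 0 < ∏ j, √(∫ s, ‖F j s‖ ^ 2) := Finset.prod_pos fun j _ => Real.sqrt_pos.2 (hF j)
  rw [hnorm, schrodinger_eq_prod_evolution hf, le_div_iff₀ hpos, norm_mul, Complex.norm_real,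
    Real.norm_of_nonneg (by positivity), norm_prod, mul_assoc, ← Finset.prod_mul_distrib]
  exact mul_le_mul_of_nonneg_left (Finset.prod_le_prod (fun j _ => by have := hr j; positivity)
    fun j _ => hrF j) (by positivity)

end Tensor

open scoped ComplexConjugate

theorem norm_circleExp_sub_one_le (θ : ℝ) : ‖(Circle.exp θ : ℂ) - 1‖ ≤ |θ| := by
  simpa [Circle.coe_exp, mul_comm] using Real.norm_exp_I_mul_ofReal_sub_one_le (x := θ)

section GaussSum

variable {q : ℕ} [NeZero q]

theorem norm_stdAddChar (x : ZMod q) : ‖ZMod.stdAddChar x‖ = 1 := by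
  rw [ZMod.stdAddChar_apply, Circle.norm_coe]

/-- Substituting `v + u` for the first summation index of `|∑ f|²` makes the sum over `v`
a complete character sum, in which only `u = 0` survives. -/
theorem norm_sum_quadratic {f : ZMod q → ℂ} {a : ZMod q} (ha : IsUnit a) (hf : ∀ v, ‖f v‖ = 1)
    (hadd : ∀ u v, f (u + v) = f u * f v * ZMod.stdAddChar (a * u * v)) :
    ‖∑ v, f v‖ = √q := by
  have hconj (v : ZMod q) : f v * conj (f v) = 1 := by simp [Complex.mul_conj', hf]
  have hzero : f 0 = 1 := by
    have h := hadd 0 0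
    rw [mul_zero, add_zero, AddChar.map_zero_eq_one, mul_one] at h
    exact (mul_eq_left₀ (norm_ne_zero_iff.1 (by simp [hf]))).1 h.symm
  have hsum (u : ZMod q) :
      ∑ v, f u * ZMod.stdAddChar (v * (a * u)) = if u = 0 then (q : ℂ) else 0 := by
    rw [← Finset.mul_sum, AddChar.sum_mulShift _ (ZMod.isPrimitive_stdAddChar q)]
    rcases eq_or_ne u 0 with rfl | hu
    · simp [hzero, ZMod.card]
    · simp [ha.mul_right_eq_zero.not.2 hu, hu]
  have hsq : (∑ v, f v) * conj (∑ v, f v) = q := by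
    calc (∑ v, f v) * conj (∑ v, f v) = ∑ v, ∑ u, f (v + u) * conj (f v) := by
          rw [map_sum, Finset.sum_mul_sum, Finset.sum_comm]
          exact Finset.sum_congr rfl fun v _ =>
            (Equiv.sum_comp (Equiv.addLeft v) fun u => f u * conj (f v)).symm
      _ = ∑ u, ∑ v, f u * ZMod.stdAddChar (v * (a * u)) := by
          rw [Finset.sum_comm]
          refine Finset.sum_congr rfl fun u _ => Finset.sum_congr rfl fun v _ => ?_
          rw [hadd, mul_left_comm v a u, ← mul_assoc a]
          linear_combination f u * ZMod.stdAddChar (a * v * u) * hconj v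
      _ = q := by simp [hsum]
  rw [Complex.mul_conj'] at hsq
  rw [← Real.sqrt_sq (norm_nonneg (∑ v, f v)), show ‖∑ v, f v‖ ^ 2 = (q : ℝ) by exact_mod_cast hsq]

theorem norm_dft_quadratic {f : ZMod q → ℂ} {a : ZMod q} (ha : IsUnit a) (hf : ∀ v, ‖f v‖ = 1)
    (hadd : ∀ u v, f (u + v) = f u * f v * ZMod.stdAddChar (a * u * v)) (c : ZMod q) :
    ‖ZMod.dft f c‖ = √q := by
  rw [ZMod.dft_apply]
  refine norm_sum_quadratic ha (fun v => by rw [norm_smul, hf, norm_stdAddChar, mul_one])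
    fun u v => ?_
  rw [hadd, add_mul, neg_add, AddChar.map_add_eq_mul]
  simp only [smul_eq_mul]
  ring

/-- The quadratic phase `e^{iπ a v² / q}`, evaluated at the representative of `v` in `[0, q)`.
It is independent of the representative when `a q` is even, see `quadPhase_intCast`. -/
noncomputable def quadPhase (a : ℤ) (q : ℕ) (v : ZMod q) : ℂ :=
  Circle.exp (Real.pi * a * (v.cast : ℤ) ^ 2 / q)

theorem quadPhase_intCast {a : ℤ} (haq : Even (a * q)) (k : ℤ) :
    quadPhase a q k = Circle.exp (Real.pi * a * k ^ 2 / q) := by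
  obtain ⟨b, hb⟩ := haq
  obtain ⟨z, hz⟩ := (ZMod.intCast_eq_intCast_iff_dvd_sub ((k : ZMod q).cast : ℤ) k q).1 (by simp)
  have hq : (q : ℝ) ≠ 0 := Nat.cast_ne_zero.2 (NeZero.ne q)
  have hk : (k : ℝ) = ((k : ZMod q).cast : ℤ) + q * z := by exact_mod_cast eq_add_of_sub_eq' hz
  have hb' : (a : ℝ) * q = 2 * b := by exact_mod_cast hb.trans (two_mul b).symm
  have hperiod : Circle.exp (((a * ((k : ZMod q).cast : ℤ) * z + b * z ^ 2 : ℤ) : ℝ) *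
      (2 * Real.pi)) = 1 := Circle.exp_eq_one.2 ⟨_, rfl⟩
  rw [quadPhase, Circle.coe_inj, ← mul_one (Circle.exp _), ← hperiod, ← Circle.exp_add, hk]
  congr 1
  push_cast
  field_simp
  linear_combination -(q * z ^ 2 : ℝ) * hb'

theorem quadPhase_add {a : ℤ} (haq : Even (a * q)) (u v : ZMod q) :
    quadPhase a q (u + v) =
      quadPhase a q u * quadPhase a q v * ZMod.stdAddChar ((a : ZMod q) * u * v) := by
  obtain ⟨u, rfl⟩ := ZMod.intCast_surjective u
  obtain ⟨v, rfl⟩ := ZMod.intCast_surjective v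
  have hq : (q : ℂ) ≠ 0 := Nat.cast_ne_zero.2 (NeZero.ne q)
  rw [← Int.cast_add, ← Int.cast_mul, ← Int.cast_mul, quadPhase_intCast haq,
    quadPhase_intCast haq, quadPhase_intCast haq, ZMod.stdAddChar_coe]
  simp only [Circle.coe_exp, ← Complex.exp_add]
  congr 1
  push_cast
  field_simp
  ring

theorem norm_dft_quadPhase {a : ℤ} (haq : Even (a * q)) (ha : IsUnit (a : ZMod q)) (c : ZMod q) :
    ‖ZMod.dft (quadPhase a q) c‖ = √q :=
  norm_dft_quadratic ha (fun _ => Circle.norm_coe _) (quadPhase_add haq) c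

end GaussSum

section FejerSum

variable {q : ℕ} [NeZero q]

/-- The Fejér-type weights `w k * conj (w l)` turn the sum into a quadratic form, whose
coefficients in the Fourier expansion of `Φ` are nonnegative. This is what keeps the error
terms below free of logarithms. -/
theorem sum_sum_mul_conj_mul_sub {ι : Type*} (s : Finset ι) (w : ι → ℂ) (g : ι → ZMod q)
    (Φ : ZMod q → ℂ) :
    ∑ k ∈ s, ∑ l ∈ s, w k * conj (w l) * Φ (g k - g l) =
      (q : ℂ)⁻¹ * ∑ c, ZMod.dft Φ c *
        ((‖∑ k ∈ s, w k * ZMod.stdAddChar (c * g k)‖ ^ 2 : ℝ) : ℂ) := by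
  have hinv (x : ZMod q) :
      Φ x = (q : ℂ)⁻¹ * ∑ c, ZMod.stdAddChar (c * x) * ZMod.dft Φ c := by
    rw [← smul_eq_mul, ← LinearEquiv.symm_apply_apply ZMod.dft Φ, ZMod.invDFT_apply]
    simp
  have hsq (c : ZMod q) : ((‖∑ k ∈ s, w k * ZMod.stdAddChar (c * g k)‖ ^ 2 : ℝ) : ℂ) =
      ∑ k ∈ s, ∑ l ∈ s, w k * conj (w l) * ZMod.stdAddChar (c * (g k - g l)) := by
    rw [Complex.ofReal_pow, ← Complex.mul_conj', map_sum, Finset.sum_mul_sum]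
    refine Finset.sum_congr rfl fun k _ => Finset.sum_congr rfl fun l _ => ?_
    rw [map_mul conj, ← AddChar.map_neg_eq_conj, mul_sub, sub_eq_add_neg, AddChar.map_add_eq_mul]
    ring
  simp only [hsq, hinv (_ - _), Finset.mul_sum]
  rw [Finset.sum_comm_cycle]
  refine Finset.sum_congr rfl fun c _ => Finset.sum_congr rfl fun k _ =>
    Finset.sum_congr rfl fun l _ => ?_
  ring

theorem card_filter_range_natCast_eq_le (M k : ℕ) :
    (((Finset.range M).filter fun l : ℕ => (k : ZMod q) = l).card : ℝ) ≤ M / q + 1 := by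
  simp only [ZMod.natCast_eq_natCast_iff, Nat.ModEq.comm (a := k)]
  rw [← Nat.count_eq_card_filter_range, Nat.count_modEq_card _ (NeZero.pos q)]
  have hdiv : ((M / q : ℕ) : ℝ) ≤ M / q := Nat.cast_div_le
  push_cast
  split_ifs <;> linarith

/-- The weighted exponential sum `∑ k < M, w k χ(c k)` over `ZMod q`. -/
noncomputable def expSum (M : ℕ) (w : ℕ → ℂ) (c : ZMod q) : ℂ :=
  ∑ k ∈ Finset.range M, w k * ZMod.stdAddChar (c * (k : ZMod q))

theorem norm_expSum_le {M : ℕ} {w : ℕ → ℂ} (hw : ∀ k, ‖w k‖ ≤ 1) (c : ZMod q) :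
    ‖expSum M w c‖ ≤ M := by
  have hterm (k : ℕ) : ‖w k * ZMod.stdAddChar (c * (k : ZMod q))‖ ≤ 1 := by
    rw [norm_mul, norm_stdAddChar, mul_one]
    exact hw k
  simpa [expSum] using norm_sum_le_of_le (Finset.range M) fun k _ => hterm k

theorem sub_le_norm_expSum_sq {M : ℕ} {w : ℕ → ℂ} {c : ZMod q} {δ : ℝ}
    (hwc : ∀ k < M, ‖w k * ZMod.stdAddChar (c * (k : ZMod q)) - 1‖ ≤ δ) :
    (M : ℝ) ^ 2 - 2 * δ * M ^ 2 ≤ ‖expSum M w c‖ ^ 2 := by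
  have hdist : ‖expSum M w c - M‖ ≤ M * δ := by
    simpa [expSum] using
      norm_sum_le_of_le (Finset.range M) fun k hk => hwc k (Finset.mem_range.1 hk)
  have hnorm : (M : ℝ) - ‖expSum M w c‖ ≤ M * δ := by
    have := (norm_sub_norm_le (M : ℂ) _).trans_eq (norm_sub_rev _ (expSum M w c))
    rw [Complex.norm_natCast] at this
    exact this.trans hdist
  nlinarith [mul_le_mul_of_nonneg_left hnorm M.cast_nonneg, sq_nonneg (‖expSum M w c‖ - M)]

theorem sum_norm_sq_expSum_le {M : ℕ} {w : ℕ → ℂ} (hw : ∀ k, ‖w k‖ ≤ 1) :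
    ∑ c : ZMod q, ‖expSum M w c‖ ^ 2 ≤ (M : ℝ) ^ 2 + q * M := by
  have hq : (0 : ℝ) < q := Nat.cast_pos.2 (NeZero.pos q)
  have hdelta (c : ZMod q) : ZMod.dft (Pi.single (0 : ZMod q) (1 : ℂ)) c = 1 := by
    rw [ZMod.dft_apply, Finset.sum_eq_single 0] <;> simp +contextual
  have hident := sum_sum_mul_conj_mul_sub (Finset.range M) w (fun k => (k : ZMod q))
    (Pi.single (0 : ZMod q) (1 : ℂ))
  simp only [hdelta, one_mul, ← Complex.ofReal_sum] at hident
  rw [eq_inv_mul_iff_mul_eq₀ (Nat.cast_ne_zero.2 (NeZero.ne q))] at hident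
  have hterm (k l : ℕ) :
      ‖w k * conj (w l) * (Pi.single (0 : ZMod q) (1 : ℂ) : ZMod q → ℂ) (k - l)‖ ≤
        if (k : ZMod q) = l then 1 else 0 := by
    simp only [norm_mul, RCLike.norm_conj, Pi.single_apply, sub_eq_zero]
    split_ifs
    · simpa using mul_le_one₀ (hw k) (norm_nonneg _) (hw l)
    · simp
  calc _ = ‖(q : ℂ) * ∑ k ∈ Finset.range M, ∑ l ∈ Finset.range M,
        w k * conj (w l) * (Pi.single (0 : ZMod q) (1 : ℂ) : ZMod q → ℂ) (k - l)‖ := by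
        simp only [expSum]
        rw [hident, Complex.norm_real, Real.norm_of_nonneg (by positivity)]
    _ ≤ q * ∑ k ∈ Finset.range M, ∑ l ∈ Finset.range M, if (k : ZMod q) = l then 1 else 0 := by
        rw [norm_mul, Complex.norm_natCast]
        gcongr
        exact norm_sum_le_of_le _ fun k _ => norm_sum_le_of_le _ fun l _ => hterm k l
    _ ≤ q * ∑ _k ∈ Finset.range M, (M / q + 1 : ℝ) := by
        gcongr with k
        rw [Finset.sum_boole]
        exact card_filter_range_natCast_eq_le M k
    _ = (M : ℝ) ^ 2 + q * M := by
        rw [Finset.sum_const, Finset.card_range, nsmul_eq_mul]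
        field_simp

theorem norm_sum_sum_sub_le {Φ : ZMod q → ℂ} {S : ℝ} (hΦ : ∀ b, ‖ZMod.dft Φ b‖ ≤ S) {M : ℕ}
    {w : ℕ → ℂ} (hw : ∀ k, ‖w k‖ ≤ 1) {c : ZMod q} {δ : ℝ}
    (hwc : ∀ k < M, ‖w k * ZMod.stdAddChar (c * (k : ZMod q)) - 1‖ ≤ δ) :
    ‖∑ k ∈ Finset.range M, ∑ l ∈ Finset.range M, w k * conj (w l) * Φ (k - l) -
      (q : ℂ)⁻¹ * ZMod.dft Φ c * M ^ 2‖ ≤ S / q * (4 * δ * M ^ 2 + q * M) := by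
  have hS : 0 ≤ S := (norm_nonneg _).trans (hΦ 0)
  have hle : ‖expSum M w c‖ ^ 2 ≤ (M : ℝ) ^ 2 :=
    pow_le_pow_left₀ (norm_nonneg _) (norm_expSum_le hw c) 2
  have hge := sub_le_norm_expSum_sq hwc
  have hsum : ∑ b ∈ Finset.univ.erase c, ‖expSum M w b‖ ^ 2 + ‖expSum M w c‖ ^ 2 ≤
      (M : ℝ) ^ 2 + q * M := by
    rw [Finset.sum_erase_add _ _ (Finset.mem_univ c)]
    exact sum_norm_sq_expSum_le hw
  have hsplit : ∑ k ∈ Finset.range M, ∑ l ∈ Finset.range M, w k * conj (w l) * Φ (k - l) -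
      (q : ℂ)⁻¹ * ZMod.dft Φ c * M ^ 2 =
      (q : ℂ)⁻¹ * (∑ b ∈ Finset.univ.erase c, ZMod.dft Φ b * ((‖expSum M w b‖ ^ 2 : ℝ) : ℂ) -
        ZMod.dft Φ c * ((M ^ 2 - ‖expSum M w c‖ ^ 2 : ℝ) : ℂ)) := by
    rw [sum_sum_mul_conj_mul_sub _ w fun k => (k : ZMod q),
      ← Finset.sum_erase_add _ _ (Finset.mem_univ c)]
    simp only [expSum]
    push_cast
    ring
  have hnorm (b : ZMod q) {r : ℝ} (hr : 0 ≤ r) : ‖ZMod.dft Φ b * (r : ℂ)‖ ≤ S * r := by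
    rw [norm_mul, Complex.norm_real, Real.norm_of_nonneg hr]
    gcongr
    exact hΦ b
  rw [hsplit, norm_mul, norm_inv, Complex.norm_natCast, div_eq_inv_mul, mul_assoc]
  gcongr
  calc _ ≤ ∑ b ∈ Finset.univ.erase c, S * ‖expSum M w b‖ ^ 2 + S * (M ^ 2 - ‖expSum M w c‖ ^ 2) :=
        norm_sub_le_of_le (norm_sum_le_of_le _ fun b _ => hnorm b (sq_nonneg _))
          (hnorm c (sub_nonneg.2 hle))
    _ = S * (∑ b ∈ Finset.univ.erase c, ‖expSum M w b‖ ^ 2 + M ^ 2 - ‖expSum M w c‖ ^ 2) := by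
        rw [← Finset.mul_sum]
        ring
    _ ≤ S * (4 * δ * M ^ 2 + q * M) := by
        gcongr
        linarith

/-- The quadratic exponential sum `∑ k, l < M, e^{i (θ (k - l)² + (k - l) φ)}`, in which each
difference `n = k - l` carries the Fejér weight `M - |n|`. -/
noncomputable def fejerSum (M : ℕ) (θ φ : ℝ) : ℂ :=
  ∑ k ∈ Finset.range M, ∑ l ∈ Finset.range M,
    (Circle.exp (θ * ((k : ℝ) - l) ^ 2 + ((k : ℝ) - l) * φ) : ℂ)

/-- The main term of the Fejér sum near the frequency `(π a / q, 2 π c / q)`: the normalized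
Gauss sum over `ZMod q` times the total weight `M ^ 2`. -/
noncomputable def gaussMain (a c : ℤ) (q M : ℕ) [NeZero q] : ℂ :=
  (q : ℂ)⁻¹ * ZMod.dft (quadPhase a q) (-c) * M ^ 2

theorem norm_gaussMain {a : ℤ} (haq : Even (a * q)) (ha : IsUnit (a : ZMod q)) (c : ℤ) (M : ℕ) :
    ‖gaussMain a c q M‖ = M ^ 2 / √q := by
  rw [gaussMain, norm_mul, norm_mul, norm_dft_quadPhase haq ha, norm_inv, norm_pow,
    Complex.norm_natCast, Complex.norm_natCast, inv_mul_eq_div, Real.sqrt_div_self',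
    one_div_mul_eq_div]

theorem norm_fejerSum_sub_gaussMain_le {a : ℤ} (haq : Even (a * q)) (ha : IsUnit (a : ZMod q))
    {c : ℤ} {M : ℕ} {φ δ : ℝ} (hφ : M * |φ - 2 * Real.pi * c / q| ≤ δ) :
    ‖fejerSum M (Real.pi * a / q) φ - gaussMain a c q M‖ ≤
      (4 * δ * M ^ 2 + q * M) / √q := by
  have hq : (q : ℂ) ≠ 0 := Nat.cast_ne_zero.2 (NeZero.ne q)
  have hw (k : ℕ) (hk : k < M) : ‖(Circle.exp (k * φ) : ℂ) *
      ZMod.stdAddChar (-(c : ZMod q) * (k : ZMod q)) - 1‖ ≤ δ := by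
    have hphase : (Circle.exp (k * φ) : ℂ) * ZMod.stdAddChar (-(c : ZMod q) * (k : ZMod q)) =
        Circle.exp (k * (φ - 2 * Real.pi * c / q)) := by
      rw [show -(c : ZMod q) * (k : ZMod q) = ((-c * k : ℤ) : ZMod q) by push_cast; ring,
        ZMod.stdAddChar_coe, Circle.coe_exp, Circle.coe_exp, ← Complex.exp_add]
      congr 1
      push_cast
      field_simp
      ring
    rw [hphase]
    refine (norm_circleExp_sub_one_le _).trans (le_trans ?_ hφ)
    rw [abs_mul, Nat.abs_cast]
    gcongr
  have hterm (k l : ℕ) :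
      (Circle.exp (Real.pi * a / q * ((k : ℝ) - l) ^ 2 + ((k : ℝ) - l) * φ) : ℂ) =
        Circle.exp (k * φ) * conj (Circle.exp (l * φ) : ℂ) * quadPhase a q (k - l) := by
    have hcast : (k : ZMod q) - l = ((k - l : ℤ) : ZMod q) := by push_cast; rfl
    rw [hcast, quadPhase_intCast haq, ← Circle.coe_inv_eq_conj, ← Circle.exp_neg,
      ← Circle.coe_mul, ← Circle.coe_mul, ← Circle.exp_add, ← Circle.exp_add]
    push_cast
    congr 2
    ring
  simp only [fejerSum, gaussMain, hterm]
  refine (norm_sum_sum_sub_le (fun b => (norm_dft_quadPhase haq ha b).le)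
    (fun k => (Circle.norm_coe _).le) hw).trans_eq ?_
  rw [Real.sqrt_div_self', one_div_mul_eq_div]

theorem norm_fejerSum_sub_gaussMain_le_mul {a : ℤ} (haq : Even (a * q)) (ha : IsUnit (a : ZMod q))
    {c : ℤ} {M : ℕ} {φ : ℝ} (hqM : 16 * q ≤ M) (hφ : M * |φ - 2 * Real.pi * c / q| ≤ 1 / 64) :
    ‖fejerSum M (Real.pi * a / q) φ - gaussMain a c q M‖ ≤ 1 / 8 * ‖gaussMain a c q M‖ := by
  have hqM' : (16 : ℝ) * q ≤ M := by exact_mod_cast hqM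
  refine (norm_fejerSum_sub_gaussMain_le haq ha hφ).trans ?_
  rw [norm_gaussMain haq ha, ← mul_div_assoc (1 / 8 : ℝ)]
  refine div_le_div_of_nonneg_right ?_ (Real.sqrt_nonneg _)
  nlinarith [M.cast_nonneg (α := ℝ)]

end FejerSum

section Bump

/-- The indicator function of the interval `(b, b + w]`, the building block of the data. -/
noncomputable def intervalBump (b w : ℝ) : ℝ → ℂ := (Set.Ioc b (b + w)).indicator 1

theorem norm_intervalBump (b w s : ℝ) :
    ‖intervalBump b w s‖ = (Set.Ioc b (b + w)).indicator 1 s := by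
  rw [intervalBump, norm_indicator_eq_indicator_norm]
  simp only [Pi.one_apply, norm_one]
  rfl

theorem memLp_intervalBump (b w : ℝ) (p : ENNReal) : MemLp (intervalBump b w) p volume :=
  memLp_indicator_const p measurableSet_Ioc 1 (Or.inr measure_Ioc_lt_top.ne)

theorem integrable_intervalBump (b w : ℝ) : Integrable (intervalBump b w) volume :=
  memLp_one_iff_integrable.1 (memLp_intervalBump b w 1)

theorem integral_mul_intervalBump (g : ℝ → ℂ) (b : ℝ) {w : ℝ} (hw : 0 ≤ w) :
    ∫ s, g s * intervalBump b w s = ∫ s in (0 : ℝ)..w, g (b + s) := by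
  rw [intervalIntegral.integral_comp_add_left, add_zero,
    intervalIntegral.integral_of_le (by linarith), ← integral_indicator measurableSet_Ioc]
  simp [intervalBump, Set.indicator_apply]

theorem integral_norm_intervalBump (b : ℝ) {w : ℝ} (hw : 0 ≤ w) :
    ∫ s, ‖intervalBump b w s‖ = w := by
  simp only [norm_intervalBump]
  rw [integral_indicator_one measurableSet_Ioc]
  simp [Measure.real, hw]

theorem integral_norm_sq_intervalBump (b : ℝ) {w : ℝ} (hw : 0 ≤ w) :
    ∫ s, ‖intervalBump b w s‖ ^ 2 = w := by
  refine Eq.trans ?_ (integral_norm_intervalBump b hw)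
  refine integral_congr_ae (ae_of_all _ fun s => ?_)
  simp only [norm_intervalBump, Set.indicator_apply]
  split_ifs <;> simp

theorem half_norm_mul_le_norm_integral {g : ℝ → ℂ} (hg : Continuous g) {w : ℝ} (hw : 0 ≤ w) {G : ℂ}
    (h : ∀ s, 0 ≤ s → s ≤ w → ‖g s - G‖ ≤ ‖G‖ / 2) :
    ‖G‖ * w / 2 ≤ ‖∫ s in (0 : ℝ)..w, g s‖ := by
  have hdiff : (w : ℂ) * G - ∫ s in (0 : ℝ)..w, g s = -∫ s in (0 : ℝ)..w, (g s - G) := by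
    rw [intervalIntegral.integral_sub (hg.intervalIntegrable _ _) (by simp)]
    simp
  have hbound : ‖∫ s in (0 : ℝ)..w, (g s - G)‖ ≤ ‖G‖ / 2 * |w - 0| :=
    intervalIntegral.norm_integral_le_of_norm_le_const fun s hs => by
      rw [Set.uIoc_of_le hw] at hs
      exact h s hs.1.le hs.2
  have htriangle := norm_sub_norm_le ((w : ℂ) * G) (∫ s in (0 : ℝ)..w, g s)
  rw [hdiff, norm_neg, norm_mul, Complex.norm_real, Real.norm_of_nonneg hw] at htriangle
  rw [sub_zero, abs_of_nonneg hw] at hbound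
  linarith

theorem abs_mul_add_mul_sq_le {s w x t : ℝ} (hs : 0 ≤ s) (hsw : s ≤ w) :
    |x * s + t * s ^ 2| ≤ w * |x| + |t| * w ^ 2 := by
  refine (abs_add_le _ _).trans ?_
  rw [abs_mul, abs_mul, abs_of_nonneg hs, abs_of_nonneg (sq_nonneg s), mul_comm w]
  gcongr

theorem evolution_intervalBump (b : ℝ) {w : ℝ} (hw : 0 ≤ w) (t x : ℝ) :
    evolution (intervalBump b w) t x = Circle.exp (x * b + t * b ^ 2) *
      ∫ s in (0 : ℝ)..w, (Circle.exp ((x + 2 * t * b) * s + t * s ^ 2) : ℂ) := by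
  rw [evolution, integral_mul_intervalBump _ b hw, ← intervalIntegral.integral_const_mul]
  congr 1
  ext s
  rw [← Circle.coe_mul, ← Circle.exp_add]
  congr 2
  ring

theorem half_le_norm_evolution_intervalBump {x t b w : ℝ} (hw : 0 ≤ w)
    (h : w * |x + 2 * t * b| + |t| * w ^ 2 ≤ 1 / 2) :
    w / 2 ≤ ‖evolution (intervalBump b w) t x‖ := by
  rw [evolution_intervalBump b hw, norm_mul, Circle.norm_coe, one_mul]
  have hg : Continuous fun s : ℝ => (Circle.exp ((x + 2 * t * b) * s + t * s ^ 2) : ℂ) := by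
    fun_prop
  simpa using half_norm_mul_le_norm_integral hg hw (G := 1) fun s hs hsw =>
    (norm_circleExp_sub_one_le _).trans
      ((abs_mul_add_mul_sq_le hs hsw).trans (h.trans_eq (by simp)))

theorem integral_norm_sq_pos {F : ℝ → ℂ} (hF : MemLp F 2 volume) (h : ∫ s, F s ≠ 0) :
    0 < ∫ s, ‖F s‖ ^ 2 := by
  refine (integral_nonneg fun s => sq_nonneg _).lt_of_ne fun hzero => h ?_
  have hint := (memLp_two_iff_integrable_sq_norm hF.aestronglyMeasurable).1 hF
  have hae := (integral_eq_zero_iff_of_nonneg (fun s => sq_nonneg ‖F s‖) hint).1 hzero.symm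
  refine integral_eq_zero_of_ae (hae.mono fun s hs => ?_)
  simpa using hs

end Bump

section FejerComb

/-- The Fejér comb: unit bumps at the points `D n`, with multiplicity `M - |n|` for `|n| < M`. -/
noncomputable def fejerComb (M : ℕ) (D : ℝ) (s : ℝ) : ℂ :=
  ∑ k ∈ Finset.range M, ∑ l ∈ Finset.range M, intervalBump (D * ((k : ℝ) - l)) 1 s

theorem memLp_fejerComb (M : ℕ) (D : ℝ) (p : ENNReal) : MemLp (fejerComb M D) p volume :=
  memLp_finsetSum _ fun _ _ => memLp_finsetSum _ fun _ _ => memLp_intervalBump _ _ p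

theorem integral_mul_fejerComb {g : ℝ → ℂ} (hg : Continuous g) (M : ℕ) (D : ℝ) :
    ∫ s, g s * fejerComb M D s =
      ∑ k ∈ Finset.range M, ∑ l ∈ Finset.range M,
        ∫ s in (0 : ℝ)..1, g (D * ((k : ℝ) - l) + s) := by
  have hint (b : ℝ) : Integrable (fun s => g s * intervalBump b 1 s) volume := by
    have : IntegrableOn g (Set.Ioc b (b + 1)) volume := hg.integrableOn_Ioc
    refine this.integrable_indicator measurableSet_Ioc |>.congr (ae_of_all _ fun s => ?_)
    simp [intervalBump, Set.indicator_apply]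
  simp only [fejerComb, Finset.mul_sum]
  rw [integral_finsetSum _ fun k _ => integrable_finsetSum _ fun l _ => hint _]
  refine Finset.sum_congr rfl fun k _ => ?_
  rw [integral_finsetSum _ fun l _ => hint _]
  exact Finset.sum_congr rfl fun l _ => integral_mul_intervalBump g _ zero_le_one

theorem integral_fejerComb (M : ℕ) (D : ℝ) : ∫ s, fejerComb M D s = M ^ 2 := by
  simpa [sq] using integral_mul_fejerComb (continuous_const (y := (1 : ℂ))) M D

theorem norm_fejerComb_le (M : ℕ) {D : ℝ} (hD : 1 ≤ D) (s : ℝ) : ‖fejerComb M D s‖ ≤ M := by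
  suffices ∀ k ∈ Finset.range M,
      ‖∑ l ∈ Finset.range M, intervalBump (D * ((k : ℝ) - l)) 1 s‖ ≤ 1 from
    (norm_sum_le_of_le _ this).trans (by simp)
  intro k _
  refine (norm_sum_le _ _).trans ?_
  simp only [norm_intervalBump, Set.indicator_apply, Pi.one_apply]
  rw [Finset.sum_boole]
  suffices h : ∀ l l' : ℕ, s ∈ Set.Ioc (D * ((k : ℝ) - l)) (D * ((k : ℝ) - l) + 1) →
      s ∈ Set.Ioc (D * ((k : ℝ) - l')) (D * ((k : ℝ) - l') + 1) → ¬l < l' by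
    refine Nat.cast_le_one.2 (Finset.card_le_one.2 fun l hl l' hl' => ?_)
    rw [Finset.mem_filter] at hl hl'
    exact le_antisymm (not_lt.1 (h l' l hl'.2 hl.2)) (not_lt.1 (h l l' hl.2 hl'.2))
  intro l l' hl hl' hlt
  have : (l : ℝ) + 1 ≤ l' := by exact_mod_cast hlt
  nlinarith [hl.1, hl'.2]

theorem integral_norm_sq_fejerComb_le (M : ℕ) {D : ℝ} (hD : 1 ≤ D) :
    ∫ s, ‖fejerComb M D s‖ ^ 2 ≤ (M : ℝ) ^ 3 := by
  have hint (k l : ℕ) : Integrable (fun s => ‖intervalBump (D * ((k : ℝ) - l)) 1 s‖) volume :=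
    (integrable_intervalBump _ _).norm
  calc ∫ s, ‖fejerComb M D s‖ ^ 2
      ≤ ∫ s, M * ∑ k ∈ Finset.range M, ∑ l ∈ Finset.range M,
          ‖intervalBump (D * ((k : ℝ) - l)) 1 s‖ := by
        refine integral_mono_of_nonneg (ae_of_all _ fun s => by positivity)
          ((integrable_finsetSum _ fun k _ => integrable_finsetSum _ fun l _ =>
            hint k l).const_mul _) (ae_of_all _ fun s => ?_)
        simp only [sq]
        exact mul_le_mul (norm_fejerComb_le M hD s)
          (norm_sum_le_of_le _ fun k _ => norm_sum_le _ _) (norm_nonneg _) M.cast_nonneg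
    _ = M * ∑ k ∈ Finset.range M, ∑ l ∈ Finset.range M,
          ∫ s, ‖intervalBump (D * ((k : ℝ) - l)) 1 s‖ := by
        rw [integral_const_mul, integral_finsetSum _ fun k _ => integrable_finsetSum _ fun l _ =>
          hint k l]
        simp only [integral_finsetSum _ fun l _ => hint _ l]
    _ = (M : ℝ) ^ 3 := by
        simp only [integral_norm_intervalBump _ zero_le_one, Finset.sum_const, Finset.card_range,
          nsmul_eq_mul]
        ring

theorem continuous_fejerSum (M : ℕ) (θ : ℝ) : Continuous (fejerSum M θ) := by
  unfold fejerSum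
  fun_prop

theorem evolution_fejerComb (M : ℕ) (D t x : ℝ) :
    evolution (fejerComb M D) t x = ∫ s in (0 : ℝ)..1,
      (Circle.exp (x * s + t * s ^ 2) : ℂ) * fejerSum M (D ^ 2 * t) (D * (x + 2 * s * t)) := by
  rw [evolution, integral_mul_fejerComb (by fun_prop)]
  simp only [fejerSum, Finset.mul_sum]
  rw [intervalIntegral.integral_finsetSum fun k _ =>
    Continuous.intervalIntegrable (by fun_prop) _ _]
  refine Finset.sum_congr rfl fun k _ => ?_
  rw [intervalIntegral.integral_finsetSum fun l _ =>
    Continuous.intervalIntegrable (by fun_prop) _ _]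
  refine Finset.sum_congr rfl fun l _ => intervalIntegral.integral_congr fun s _ => ?_
  simp only [← Circle.coe_mul, ← Circle.exp_add]
  congr 2
  ring

theorem norm_exp_mul_fejerSum_sub_gaussMain_le {a c : ℤ} {q M : ℕ} [NeZero q]
    (haq : Even (a * q)) (ha : IsUnit (a : ZMod q)) {φ ψ : ℝ} (hψ : |ψ| ≤ 5 / 16)
    (hqM : 16 * q ≤ M) (hφ : M * |φ - 2 * Real.pi * c / q| ≤ 1 / 64) :
    ‖(Circle.exp ψ : ℂ) * fejerSum M (Real.pi * a / q) φ - gaussMain a c q M‖ ≤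
      ‖gaussMain a c q M‖ / 2 := by
  have hsum := norm_fejerSum_sub_gaussMain_le_mul haq ha hqM hφ
  set A := fejerSum M (Real.pi * a / q) φ
  set G := gaussMain a c q M
  have hphase : ‖((Circle.exp ψ : ℂ) - 1) * G‖ ≤ 5 / 16 * ‖G‖ := by
    rw [norm_mul]
    gcongr
    exact (norm_circleExp_sub_one_le _).trans hψ
  calc ‖(Circle.exp ψ : ℂ) * A - G‖
      = ‖(Circle.exp ψ : ℂ) * (A - G) + ((Circle.exp ψ : ℂ) - 1) * G‖ := by
        congr 1
        ring
    _ ≤ ‖A - G‖ + ‖((Circle.exp ψ : ℂ) - 1) * G‖ := by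
        refine (norm_add_le _ _).trans_eq ?_
        rw [norm_mul, Circle.norm_coe, one_mul]
    _ ≤ ‖G‖ / 2 := by linarith [norm_nonneg G]

theorem le_norm_evolution_fejerComb {a c : ℤ} {q M : ℕ} [NeZero q] (haq : Even (a * q))
    (ha : IsUnit (a : ZMod q)) {D x t : ℝ} (hD : 0 ≤ D) (ht : D ^ 2 * t = Real.pi * a / q)
    (hxt : |x| + |t| ≤ 5 / 16) (hqM : 16 * q ≤ M)
    (hδ : M * (|D * x - 2 * Real.pi * c / q| + 2 * D * |t|) ≤ 1 / 64) :
    (M : ℝ) ^ 2 / (2 * √q) ≤ ‖evolution (fejerComb M D) t x‖ := by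
  have hclose (s : ℝ) (hs : 0 ≤ s) (hs1 : s ≤ 1) : ‖(Circle.exp (x * s + t * s ^ 2) : ℂ) *
      fejerSum M (D ^ 2 * t) (D * (x + 2 * s * t)) - gaussMain a c q M‖ ≤
        ‖gaussMain a c q M‖ / 2 := by
    have hφ : M * |D * (x + 2 * s * t) - 2 * Real.pi * c / q| ≤ 1 / 64 := by
      refine le_trans ?_ hδ
      gcongr
      rw [show D * (x + 2 * s * t) - 2 * Real.pi * c / q =
        (D * x - 2 * Real.pi * c / q) + s * (2 * D * t) by ring]
      refine (abs_add_le _ _).trans ?_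
      rw [abs_mul s, abs_mul (2 * D), abs_of_nonneg hs, abs_of_nonneg (mul_nonneg zero_le_two hD)]
      exact add_le_add_right (mul_le_of_le_one_left (by positivity) hs1) _
    have hψ := (abs_mul_add_mul_sq_le (x := x) (t := t) hs hs1).trans
      (le_of_eq_of_le (by ring) hxt)
    rw [ht]
    exact norm_exp_mul_fejerSum_sub_gaussMain_le haq ha hψ hqM hφ
  have hcont : Continuous fun s : ℝ => (Circle.exp (x * s + t * s ^ 2) : ℂ) *
      fejerSum M (D ^ 2 * t) (D * (x + 2 * s * t)) :=
    Continuous.mul (by fun_prop) ((continuous_fejerSum M _).comp (by fun_prop))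
  rw [evolution_fejerComb, mul_comm (2 : ℝ), ← div_div, ← norm_gaussMain haq ha c M,
    ← mul_one ‖gaussMain a c q M‖]
  exact half_norm_mul_le_norm_integral hcont zero_le_one hclose

end FejerComb

section Arithmetic

theorem exists_simultaneous_approx {ι : Type*} [Fintype ι] (y : ι → ℝ) {P : ℕ} (hP : 0 < P) :
    ∃ q : ℕ, 0 < q ∧ q ≤ P ^ Fintype.card ι ∧
      ∃ c : ι → ℤ, ∀ j, |y j - c j / q| ≤ 1 / (q * P) := by
  classical
  have hP' : (0 : ℝ) < P := Nat.cast_pos.2 hP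
  have hlt (k : ℕ) (j : ι) : ⌊P * Int.fract (k * y j)⌋₊ < P := by
    rw [Nat.floor_lt (by positivity)]
    exact mul_lt_of_lt_one_right hP' (Int.fract_lt_one _)
  let cell : Fin (P ^ Fintype.card ι + 1) → (ι → Fin P) := fun k j =>
    ⟨⌊P * Int.fract ((k : ℕ) * y j)⌋₊, hlt k j⟩
  obtain ⟨k, l, hne, hcell⟩ := Fintype.exists_ne_map_eq_of_card_lt cell (by simp)
  wlog hkl : (k : ℕ) < l generalizing k l
  · exact this l k hne.symm hcell.symm (lt_of_le_of_ne (not_lt.1 hkl) (Fin.val_ne_of_ne hne.symm))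
  have hq : ((l - k : ℕ) : ℝ) = (l : ℕ) - (k : ℕ) := Nat.cast_sub hkl.le
  have hq0 : (0 : ℝ) < (l : ℕ) - (k : ℕ) := sub_pos.2 (Nat.cast_lt.2 hkl)
  refine ⟨l - k, Nat.sub_pos_of_lt hkl, by omega, fun j => ⌊(l : ℕ) * y j⌋ - ⌊(k : ℕ) * y j⌋,
    fun j => ?_⟩
  have hfract : |P * (Int.fract ((l : ℕ) * y j) - Int.fract ((k : ℕ) * y j))| ≤ 1 := by
    have hj : ⌊P * Int.fract ((l : ℕ) * y j)⌋ = ⌊P * Int.fract ((k : ℕ) * y j)⌋ := by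
      have := congrArg Fin.val (congrFun hcell j)
      rw [← Int.natCast_floor_eq_floor (by positivity), ← Int.natCast_floor_eq_floor
        (by positivity)]
      exact_mod_cast this.symm
    rw [mul_sub]
    exact (Int.abs_sub_lt_one_of_floor_eq_floor hj).le
  have hdiff : y j - ((⌊(l : ℕ) * y j⌋ - ⌊(k : ℕ) * y j⌋ : ℤ) : ℝ) / (l - k : ℕ) =
      P * (Int.fract ((l : ℕ) * y j) - Int.fract ((k : ℕ) * y j)) / ((l - k : ℕ) * P) := by
    rw [hq]
    simp only [Int.fract, Int.cast_sub]
    field_simp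
    ring
  rw [hdiff, abs_div, abs_of_pos (by rw [hq]; positivity : (0 : ℝ) < (l - k : ℕ) * P)]
  gcongr

/-- The sum of the reciprocals of the prime factors of `q`; it controls `φ(q) / q` from below and
is bounded on average, so that `φ(q) / q` is bounded below for most `q`. -/
noncomputable def primeFactorsRecip (q : ℕ) : ℝ := ∑ r ∈ q.primeFactors, (r : ℝ)⁻¹

theorem primeFactorsRecip_nonneg (q : ℕ) : 0 ≤ primeFactorsRecip q :=
  Finset.sum_nonneg fun r _ => by positivity

theorem sum_primeFactorsRecip_le (Q : ℕ) :
    ∑ q ∈ Finset.Ioc 0 Q, primeFactorsRecip q ≤ Q := by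
  have hdvd : ∀ q ∈ Finset.Ioc 0 Q, primeFactorsRecip q ≤
      ∑ r ∈ Finset.Ioc 1 Q, if r ∣ q then (r : ℝ)⁻¹ else 0 := by
    intro q hq
    rw [Finset.mem_Ioc] at hq
    rw [primeFactorsRecip, ← Finset.sum_filter]
    refine Finset.sum_le_sum_of_subset_of_nonneg (fun r hr => ?_) fun _ _ _ => by positivity
    have hrq := Nat.dvd_of_mem_primeFactors hr
    simp only [Finset.mem_filter, Finset.mem_Ioc]
    exact ⟨⟨(Nat.prime_of_mem_primeFactors hr).one_lt, (Nat.le_of_dvd hq.1 hrq).trans hq.2⟩, hrq⟩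
  have hmultiples (r : ℕ) : (∑ q ∈ Finset.Ioc 0 Q, if r ∣ q then (r : ℝ)⁻¹ else 0) ≤
      Q * ((r : ℝ) ^ 2)⁻¹ := by
    rw [← Finset.sum_filter, Finset.sum_const, Nat.Ioc_filter_dvd_card_eq_div, nsmul_eq_mul, sq,
      mul_inv, ← mul_assoc, ← div_eq_mul_inv (Q : ℝ)]
    exact mul_le_mul_of_nonneg_right Nat.cast_div_le (by positivity)
  have hsquares : ∑ r ∈ Finset.Ioc 1 Q, ((r : ℝ) ^ 2)⁻¹ ≤ 1 := by
    rcases Nat.eq_zero_or_pos Q with rfl | hQ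
    · simp
    · exact (sum_Ioc_inv_sq_le_sub one_ne_zero hQ).trans (by simp)
  calc ∑ q ∈ Finset.Ioc 0 Q, primeFactorsRecip q
      ≤ ∑ r ∈ Finset.Ioc 1 Q, ∑ q ∈ Finset.Ioc 0 Q, if r ∣ q then (r : ℝ)⁻¹ else 0 :=
        (Finset.sum_le_sum hdvd).trans_eq Finset.sum_comm
    _ ≤ Q * ∑ r ∈ Finset.Ioc 1 Q, ((r : ℝ) ^ 2)⁻¹ := by
        rw [Finset.mul_sum]
        exact Finset.sum_le_sum fun r _ => hmultiples r
    _ ≤ Q := mul_le_of_le_one_right Q.cast_nonneg hsquares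

theorem card_primeFactorsRecip_gt_le (Q : ℕ) {K : ℝ} (hK : 0 < K) :
    (((Finset.Ioc 0 Q).filter fun q => K < primeFactorsRecip q).card : ℝ) ≤ Q / K := by
  rw [le_div_iff₀ hK, ← nsmul_eq_mul]
  refine (Finset.card_nsmul_le_sum _ primeFactorsRecip K fun q hq =>
    (Finset.mem_filter.1 hq).2.le).trans ((Finset.sum_le_sum_of_subset_of_nonneg
      (Finset.filter_subset _ _) fun q _ _ => primeFactorsRecip_nonneg q).trans
        (sum_primeFactorsRecip_le Q))

theorem exp_neg_two_mul_le_one_sub {x : ℝ} (hx0 : 0 ≤ x) (hx : x ≤ 1 / 2) :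
    Real.exp (-2 * x) ≤ 1 - x := by
  have hpos : 0 < 1 - x := by linarith
  rw [← Real.le_log_iff_exp_le hpos]
  refine le_trans ?_ (Real.one_sub_inv_le_log_of_pos hpos)
  have : (1 - x)⁻¹ ≤ 1 + 2 * x := by
    rw [inv_le_iff_one_le_mul₀ hpos]
    nlinarith
  linarith

theorem exp_mul_le_totient (q : ℕ) :
    Real.exp (-2 * primeFactorsRecip q) * q ≤ q.totient := by
  have htotient : (q.totient : ℝ) = q * ∏ r ∈ q.primeFactors, (1 - (r : ℝ)⁻¹) := by
    simpa using congrArg (Rat.cast : ℚ → ℝ) (Nat.totient_eq_mul_prod_factors q)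
  rw [htotient, mul_comm, primeFactorsRecip, Finset.mul_sum, Real.exp_sum]
  gcongr with r hr
  refine exp_neg_two_mul_le_one_sub (by positivity) ?_
  rw [inv_eq_one_div]
  gcongr
  exact_mod_cast (Nat.prime_of_mem_primeFactors hr).two_le

theorem card_filter_coprime_range_mul (q J : ℕ) :
    ((Finset.range (q * J)).filter q.Coprime).card = J * q.totient := by
  induction J with
  | zero => simp
  | succ J ih =>
    have hunion : Finset.range (q * (J + 1)) =
        Finset.range (q * J) ∪ Finset.Ico (q * J) (q * J + q) := by
      simp only [Finset.range_eq_Ico, mul_add_one]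
      exact (Finset.Ico_union_Ico_eq_Ico (Nat.zero_le _) (Nat.le_add_right _ _)).symm
    have hdisj : Disjoint (Finset.range (q * J)) (Finset.Ico (q * J) (q * J + q)) := by
      rw [Finset.range_eq_Ico]
      exact Finset.Ico_disjoint_Ico_consecutive _ _ _
    rw [hunion, Finset.filter_union, Finset.card_union_of_disjoint
      (Finset.disjoint_filter_filter hdisj), ih, Nat.filter_coprime_Ico_eq_totient, add_one_mul]

/-- The numerators `a` for which the quadratic Gauss sum `∑ exp (π i a v ^ 2 / q)` over `ℤ / q` is
well defined and has modulus `√q`. -/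
def gaussNumerators (q : ℕ) : Set ℤ := {a | IsUnit (a : ZMod q) ∧ Even (a * q)}

/-- Even `q` allows every numerator coprime to it, odd `q` only the even ones. -/
theorem exists_finset_gaussNumerators (q J : ℕ) :
    ∃ s : Finset ℕ, s.card = J * q.totient ∧
      ∀ a ∈ s, (a : ℤ) ∈ gaussNumerators q ∧ a + 1 ≤ 2 * (q * J) := by
  obtain ⟨σ, hσ0, hσ2, hcoprime, heven⟩ :
      ∃ σ : ℕ, 0 < σ ∧ σ ≤ 2 ∧ σ.Coprime q ∧ Even (σ * q) := by
    rcases Nat.even_or_odd q with hq | hq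
    · exact ⟨1, by simpa using hq⟩
    · exact ⟨2, two_pos, le_rfl, Nat.coprime_two_left.2 hq, even_two_mul q⟩
  refine ⟨((Finset.range (q * J)).filter q.Coprime).image (σ * ·), ?_, fun a ha => ?_⟩
  · rw [Finset.card_image_of_injective _ (mul_right_injective₀ hσ0.ne'),
      card_filter_coprime_range_mul]
  · simp only [Finset.mem_image, Finset.mem_filter, Finset.mem_range] at ha
    obtain ⟨b, ⟨hb, hqb⟩, rfl⟩ := ha
    refine ⟨⟨?_, ?_⟩, by nlinarith⟩
    · simpa using (ZMod.isUnit_iff_coprime (σ * b) q).2 (hcoprime.mul_left hqb.symm)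
    · exact_mod_cast (by rw [mul_right_comm]; exact heven.mul_right b : Even (σ * b * q))

end Arithmetic

section RationalNhd

/-- The points of `[0, ρ)` within `lam * δ` of some `lam * a / q` with numerator `a ∈ A`. -/
def rationalNhd (A : Set ℤ) (lam ρ δ : ℝ) (q : ℕ) : Set ℝ :=
  Set.Ico 0 ρ ∩ {x | ∃ a ∈ A, |x / lam - a / q| ≤ δ}

theorem measurableSet_rationalNhd (A : Set ℤ) (lam ρ δ : ℝ) (q : ℕ) :
    MeasurableSet (rationalNhd A lam ρ δ q) := by
  have : {x : ℝ | ∃ a ∈ A, |x / lam - a / q| ≤ δ} = ⋃ a ∈ A, {x : ℝ | |x / lam - a / q| ≤ δ} := by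
    ext x
    simp only [Set.mem_ofPred_eq, Set.mem_iUnion, exists_prop]
  rw [rationalNhd, this]
  exact measurableSet_Ico.inter <| .biUnion A.to_countable fun a _ =>
    measurableSet_le (by fun_prop) measurable_const

theorem card_Icc_neg_one_floor_le {y : ℝ} (hy : 1 ≤ y) :
    ((Finset.Icc (-1) ⌊y + 1⌋).card : ℝ) ≤ 4 * y := by
  have hfloor : 0 ≤ ⌊y + 1⌋ := Int.floor_nonneg.2 (by linarith)
  have hcard : ((Finset.Icc (-1) ⌊y + 1⌋).card : ℤ) = ⌊y + 1⌋ + 2 := by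
    rw [Int.card_Icc, Int.toNat_of_nonneg (by omega)]
    ring
  have hcast : ((Finset.Icc (-1) ⌊y + 1⌋).card : ℝ) = (⌊y + 1⌋ : ℝ) + 2 := by exact_mod_cast hcard
  linarith [Int.floor_le (y + 1)]

theorem volume_rationalNhd_le (A : Set ℤ) {lam ρ δ : ℝ} {q : ℕ} (hlam : 0 < lam) (hρ : lam ≤ ρ)
    (hq : 0 < q) (hδ : 0 ≤ δ) (hδq : δ ≤ 1 / q) :
    volume (rationalNhd A lam ρ δ q) ≤ ENNReal.ofReal (8 * q * δ * ρ) := by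
  have hq0 : (0 : ℝ) < q := Nat.cast_pos.2 hq
  have hq1 : (1 : ℝ) ≤ q := Nat.one_le_cast.2 hq
  have hL : 1 ≤ ρ / lam := (one_le_div hlam).2 hρ
  set s : Finset ℤ := Finset.Icc (-1) ⌊q * (ρ / lam) + 1⌋
  set I : ℤ → Set ℝ := fun a => Set.Icc (lam * (a / q - δ)) (lam * (a / q + δ)) with hI
  have hcover : rationalNhd A lam ρ δ q ⊆ ⋃ a ∈ s, I a := by
    rintro x ⟨⟨hx0, hxρ⟩, a, -, ha⟩
    have hxlam : lam * (x / lam) = x := mul_div_cancel₀ x hlam.ne'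
    have hxL : x / lam ≤ ρ / lam := by gcongr
    have hx0' : 0 ≤ x / lam := by positivity
    have ha' : |q * (x / lam) - a| ≤ 1 := by
      rw [show q * (x / lam) - a = q * (x / lam - a / q) by field_simp, abs_mul, Nat.abs_cast]
      exact (mul_le_mul_of_nonneg_left (ha.trans hδq) hq0.le).trans_eq (mul_one_div_cancel hq0.ne')
    rw [abs_le] at ha ha'
    refine Set.mem_biUnion (x := a) (Finset.mem_Icc.2 ⟨?_, Int.le_floor.2 ?_⟩) ⟨?_, ?_⟩
    · have : 0 ≤ q * (x / lam) := by positivity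
      exact_mod_cast (by linarith : (-1 : ℝ) ≤ a)
    · have : q * (x / lam) ≤ q * (ρ / lam) := by gcongr
      linarith
    · rw [← hxlam]; gcongr; linarith
    · rw [← hxlam]; gcongr; linarith
  have hcard : (s.card : ℝ) ≤ 4 * (q * (ρ / lam)) :=
    card_Icc_neg_one_floor_le (one_le_mul_of_one_le_of_one_le hq1 hL)
  calc volume (rationalNhd A lam ρ δ q)
      ≤ ∑ a ∈ s, volume (I a) := (measure_mono hcover).trans (measure_biUnion_finset_le _ _)
    _ = ∑ a ∈ s, ENNReal.ofReal (2 * δ * lam) := by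
        refine Finset.sum_congr rfl fun a _ => ?_
        rw [hI, Real.volume_Icc]
        congr 1
        ring
    _ = ENNReal.ofReal (s.card * (2 * δ * lam)) := by
        rw [Finset.sum_const, nsmul_eq_mul, ENNReal.ofReal_mul (Nat.cast_nonneg _),
          ENNReal.ofReal_natCast]
    _ ≤ ENNReal.ofReal (8 * q * δ * ρ) := by
        refine ENNReal.ofReal_le_ofReal ?_
        calc s.card * (2 * δ * lam) ≤ 4 * (q * (ρ / lam)) * (2 * δ * lam) := by gcongr
          _ = 8 * q * δ * ρ := by field_simp; ring

theorem card_mul_le_volume_rationalNhd {A : Set ℤ} {lam ρ : ℝ} {q : ℕ} (hlam : 0 < lam)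
    (hq : 0 < q) {s : Finset ℕ} (hsA : ∀ a ∈ s, (a : ℤ) ∈ A)
    (hsρ : ∀ a ∈ s, lam * (a + 1) ≤ q * ρ) :
    ENNReal.ofReal (s.card * (lam / q)) ≤ volume (rationalNhd A lam ρ (1 / q) q) := by
  have hq0 : (0 : ℝ) < q := Nat.cast_pos.2 hq
  set I : ℕ → Set ℝ := fun a => Set.Ico (lam / q * a) (lam / q * (a + 1 : ℕ)) with hI
  have hdisj : Pairwise (Function.onFun Disjoint I) :=
    Monotone.pairwise_disjoint_on_Ico_succ (f := fun a : ℕ => lam / q * a) fun a b hab => by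
      dsimp only
      gcongr
  have hsub : (⋃ a ∈ s, I a) ⊆ rationalNhd A lam ρ (1 / q) q := by
    simp only [Set.iUnion_subset_iff]
    rintro a ha x ⟨hax, hxa⟩
    refine ⟨⟨le_trans (by positivity) hax, hxa.trans_le ?_⟩, a, hsA a ha, ?_⟩
    · rw [div_mul_eq_mul_div, div_le_iff₀ hq0, mul_comm ρ]
      exact_mod_cast hsρ a ha
    · have hlower : (a : ℝ) / q ≤ x / lam := by
        rw [le_div_iff₀ hlam]
        exact le_of_eq_of_le (by ring) hax
      have hupper : x / lam ≤ a / q + 1 / q := by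
        rw [div_le_iff₀ hlam]
        refine hxa.le.trans_eq ?_
        push_cast
        ring
      rw [Int.cast_natCast, abs_of_nonneg (sub_nonneg.2 hlower)]
      linarith
  calc ENNReal.ofReal (s.card * (lam / q)) = ∑ a ∈ s, volume (I a) := by
        simp only [hI, Real.volume_Ico, Nat.cast_add, Nat.cast_one, mul_add, mul_one,
          add_sub_cancel_left]
        rw [Finset.sum_const, nsmul_eq_mul, ENNReal.ofReal_mul (Nat.cast_nonneg _),
          ENNReal.ofReal_natCast]
    _ = volume (⋃ a ∈ s, I a) :=
        (measure_biUnion_finset (hdisj.set_pairwise _) fun _ _ => measurableSet_Ico).symm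
    _ ≤ volume (rationalNhd A lam ρ (1 / q) q) := measure_mono hsub

theorem le_volume_rationalNhd_gaussNumerators {lam ρ η : ℝ} {q : ℕ} (hlam : 0 < lam)
    (hρ : 2 * lam ≤ ρ) (hq : 0 < q) (hη : η * q ≤ q.totient) :
    ENNReal.ofReal (η * ρ / 4) ≤ volume (rationalNhd (gaussNumerators q) lam ρ (1 / q) q) := by
  have hρ0 : 0 < ρ := by linarith
  have hL : 1 ≤ ρ / lam / 2 := by
    rw [div_div, one_le_div (by positivity)]
    linarith
  set J : ℕ := ⌊ρ / lam / 2⌋₊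
  have hJle : (J : ℝ) ≤ ρ / lam / 2 := Nat.floor_le (by positivity)
  have hJge : ρ / lam / 4 ≤ J := by
    have : (1 : ℝ) ≤ J := by exact_mod_cast (Nat.one_le_floor_iff _).2 hL
    linarith [Nat.lt_floor_add_one (ρ / lam / 2)]
  obtain ⟨s, hcard, hs⟩ := exists_finset_gaussNumerators q J
  refine le_trans (ENNReal.ofReal_le_ofReal ?_) (card_mul_le_volume_rationalNhd hlam hq
    (fun a ha => (hs a ha).1) fun a ha => ?_)
  · rw [hcard]
    push_cast
    calc η * ρ / 4 = (ρ / lam / 4) * (η * q) * (lam / q) := by field_simp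
      _ ≤ (ρ / lam / 4) * q.totient * (lam / q) := by gcongr
      _ ≤ J * q.totient * (lam / q) := by gcongr
  · have ha' : (a : ℝ) + 1 ≤ 2 * (q * J) := by exact_mod_cast (hs a ha).2
    calc lam * (a + 1) ≤ lam * (2 * (q * (ρ / lam / 2))) := by gcongr; exact ha'.trans (by gcongr)
      _ = q * ρ := by field_simp

end RationalNhd

section Blocks

variable {α β : Type*} {k d : ℕ}

/-- The family `(b, …, b, c, …, c)` in which `b` occupies the first `d` places. -/
def splitAt (d : ℕ) (b c : α) : Fin k → α := fun j => if (j : ℕ) < d then b else c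

/-- The family `(a, b, …, b, c, …, c)` in which `b` occupies `d` places. The first coordinate
carries the frequency `R`, the next `d` resonate, and the others stay in a bump. -/
def blocks (d : ℕ) (a b c : α) : Fin (k + 1) → α := Fin.cons a (splitAt d b c)

@[simp] theorem blocks_zero (a b c : α) : blocks (k := k) d a b c 0 = a := rfl

@[simp] theorem blocks_succ (a b c : α) (j : Fin k) :
    blocks d a b c j.succ = splitAt d b c j := rfl

theorem splitAt_of_lt {j : Fin k} (hj : (j : ℕ) < d) (b c : α) : splitAt d b c j = b := if_pos hj

theorem splitAt_of_not_lt {j : Fin k} (hj : ¬(j : ℕ) < d) (b c : α) : splitAt d b c j = c :=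
  if_neg hj

theorem map_splitAt (f : α → β) (b c : α) (j : Fin k) :
    f (splitAt d b c j) = splitAt d (f b) (f c) j :=
  apply_ite f _ b c

theorem forall_splitAt {p : α → Prop} {b c : α} (hb : p b) (hc : p c) (j : Fin k) :
    p (splitAt d b c j) := by
  by_cases hj : (j : ℕ) < d
  · rwa [splitAt_of_lt hj]
  · rwa [splitAt_of_not_lt hj]

theorem forall_blocks {p : α → Prop} {a b c : α} (ha : p a) (hb : p b) (hc : p c)
    (j : Fin (k + 1)) : p (blocks d a b c j) :=
  Fin.cases ha (forall_splitAt hb hc) j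

theorem prod_splitAt [CommMonoid α] (hd : d ≤ k) (b c : α) :
    ∏ j : Fin k, splitAt d b c j = b ^ d * c ^ (k - d) := by
  obtain ⟨e, rfl⟩ := Nat.exists_eq_add_of_le hd
  simp [Fin.prod_univ_add, splitAt]

theorem prod_blocks [CommMonoid α] (hd : d ≤ k) (a b c : α) :
    ∏ j : Fin (k + 1), blocks d a b c j = a * (b ^ d * c ^ (k - d)) := by
  rw [Fin.prod_univ_succ, blocks_zero]
  simp only [blocks_succ, prod_splitAt hd]

theorem volume_pi_splitAt (hd : d ≤ k) (S T : Set ℝ) :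
    volume (Set.univ.pi (splitAt d S T : Fin k → Set ℝ)) =
      volume S ^ d * volume T ^ (k - d) := by
  rw [volume_pi_pi]
  simp only [map_splitAt, prod_splitAt hd]

theorem volume_pi_blocks (hd : d ≤ k) (S T U : Set ℝ) :
    volume (Set.univ.pi (blocks d S T U : Fin (k + 1) → Set ℝ)) =
      volume S * (volume T ^ d * volume U ^ (k - d)) := by
  rw [volume_pi_pi, Fin.prod_univ_succ]
  simp only [blocks_zero, blocks_succ, map_splitAt, prod_splitAt hd]

end Blocks

section Covering

theorem mul_measure_biUnion_le_prod {α β ι : Type*} [MeasurableSpace α] [MeasurableSpace β]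
    (μ : Measure α) (ν : Measure β) [SFinite μ] [SFinite ν] (s : Finset ι) {S : ι → Set α}
    {Y : ι → Set β} (hS : ∀ i, MeasurableSet (S i)) (hY : ∀ i, MeasurableSet (Y i))
    {κ : ENNReal} (hκ : ∀ i ∈ s, κ ≤ μ (S i)) :
    κ * ν (⋃ i ∈ s, Y i) ≤ μ.prod ν (⋃ i ∈ s, S i ×ˢ Y i) := by
  rw [Measure.prod_apply_symm (Finset.measurableSet_biUnion _ fun i _ => (hS i).prod (hY i)),
    ← setLIntegral_const]
  refine (setLIntegral_mono' (Finset.measurableSet_biUnion _ fun i _ => hY i) fun y hy => ?_).trans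
    (setLIntegral_le_lintegral _ _)
  obtain ⟨i, hi, hyi⟩ := Set.mem_iUnion₂.1 hy
  exact (hκ i hi).trans (measure_mono fun x hx => Set.mem_biUnion (x := i) hi ⟨hx, hyi⟩)

theorem mul_volume_biUnion_le_pi_cons {ι : Type*} {k : ℕ} (s : Finset ι) {S : ι → Set ℝ}
    {Y : ι → Fin k → Set ℝ} (hS : ∀ i, MeasurableSet (S i)) (hY : ∀ i j, MeasurableSet (Y i j))
    {κ : ENNReal} (hκ : ∀ i ∈ s, κ ≤ volume (S i)) :
    κ * volume (⋃ i ∈ s, Set.univ.pi (Y i)) ≤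
      volume (⋃ i ∈ s, Set.univ.pi (Fin.cons (S i) (Y i) : Fin (k + 1) → Set ℝ)) := by
  have hY' (i : ι) : MeasurableSet (Set.univ.pi (Y i)) := .univ_pi (hY i)
  have hpre : (⋃ i ∈ s, Set.univ.pi (Fin.cons (S i) (Y i) : Fin (k + 1) → Set ℝ)) =
      MeasurableEquiv.piFinSuccAbove (fun _ : Fin (k + 1) => ℝ) 0 ⁻¹'
        ⋃ i ∈ s, S i ×ˢ Set.univ.pi (Y i) := by
    ext x
    simp only [Set.mem_preimage, Set.mem_iUnion, Set.mem_prod, Set.mem_univ_pi,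
      Fin.forall_fin_succ, Fin.cons_zero, Fin.cons_succ]
    rfl
  rw [hpre, (volume_preserving_piFinSuccAbove (fun _ : Fin (k + 1) => ℝ) 0).measure_preimage
    (Finset.measurableSet_biUnion _ fun i _ => (hS i).prod (hY' i)).nullMeasurableSet]
  exact mul_measure_biUnion_le_prod _ _ s hS hY' hκ

theorem measure_le_biUnion_add_card_mul {α ι : Type*} [MeasurableSpace α] [DecidableEq ι]
    (μ : Measure α) {B : Set α} {Y : ι → Set α} (s t : Finset ι) {b : ENNReal}
    (hB : B ⊆ ⋃ i ∈ s, Y i) (hb : ∀ i ∈ s, μ (Y i) ≤ b) :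
    μ B ≤ μ (⋃ i ∈ t, Y i) + (s \ t).card * b := by
  have hcover : B ⊆ (⋃ i ∈ t, Y i) ∪ ⋃ i ∈ s \ t, Y i := by
    intro x hx
    obtain ⟨i, hi, hxi⟩ := Set.mem_iUnion₂.1 (hB hx)
    by_cases hit : i ∈ t
    · exact Or.inl (Set.mem_biUnion (x := i) hit hxi)
    · exact Or.inr (Set.mem_biUnion (x := i) (Finset.mem_sdiff.2 ⟨hi, hit⟩) hxi)
  refine (measure_mono hcover).trans ((measure_union_le _ _).trans ?_)
  gcongr
  refine (measure_biUnion_finset_le _ _).trans ?_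
  rw [← nsmul_eq_mul]
  exact Finset.sum_le_card_nsmul _ _ _ fun i hi => hb i (Finset.mem_sdiff.1 hi).1

/-- The denominators `q ≤ Q` that are comparable to `Q` and for which `φ(q)` is comparable
to `q`. -/
noncomputable def goodDenoms (Q : ℕ) (ε : ℝ) : Finset ℕ :=
  (Finset.Ioc 0 Q).filter fun q => ε * Q ≤ q ∧ primeFactorsRecip q ≤ 1 / ε

theorem mem_goodDenoms {Q q : ℕ} {ε : ℝ} :
    q ∈ goodDenoms Q ε ↔ (0 < q ∧ q ≤ Q) ∧ ε * Q ≤ q ∧ primeFactorsRecip q ≤ 1 / ε := by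
  rw [goodDenoms, Finset.mem_filter, Finset.mem_Ioc]

theorem card_not_goodDenoms_le (Q : ℕ) {ε : ℝ} (hε : 0 < ε) :
    ((Finset.Ioc 0 Q \ goodDenoms Q ε).card : ℝ) ≤ 2 * ε * Q := by
  have hsub : Finset.Ioc 0 Q \ goodDenoms Q ε ⊆ Finset.Ioc 0 ⌊ε * Q⌋₊ ∪
      (Finset.Ioc 0 Q).filter fun q => 1 / ε < primeFactorsRecip q := by
    intro q hq
    simp only [goodDenoms, Finset.mem_sdiff, Finset.mem_filter, not_and, not_le] at hq
    simp only [Finset.mem_union, Finset.mem_filter]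
    by_cases h : ε * Q ≤ q
    · exact Or.inr ⟨hq.1, hq.2 hq.1 h⟩
    · exact Or.inl (Finset.mem_Ioc.2 ⟨(Finset.mem_Ioc.1 hq.1).1, Nat.le_floor (not_le.1 h).le⟩)
  have hunion : ((Finset.Ioc 0 Q \ goodDenoms Q ε).card : ℝ) ≤ (Finset.Ioc 0 ⌊ε * Q⌋₊).card +
      ((Finset.Ioc 0 Q).filter fun q => 1 / ε < primeFactorsRecip q).card := by
    exact_mod_cast (Finset.card_le_card hsub).trans (Finset.card_union_le _ _)
  have hsmall : ((Finset.Ioc 0 ⌊ε * Q⌋₊).card : ℝ) ≤ ε * Q := by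
    rw [Nat.card_Ioc, Nat.sub_zero]
    exact Nat.floor_le (by positivity)
  have hrecip := card_primeFactorsRecip_gt_le Q (one_div_pos.2 hε)
  rw [show (Q : ℝ) / (1 / ε) = ε * Q by field_simp] at hrecip
  linarith

theorem exp_mul_le_totient_of_mem_goodDenoms {Q q : ℕ} {ε : ℝ} (hq : q ∈ goodDenoms Q ε) :
    Real.exp (-2 * (1 / ε)) * q ≤ q.totient := by
  refine le_trans ?_ (exp_mul_le_totient q)
  gcongr ?_ * _
  exact Real.exp_le_exp.2 (by linarith [(mem_goodDenoms.1 hq).2.2])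

theorem pi_Ico_subset_biUnion_rationalNhd {k d : ℕ} (hd : d ≤ k) (lam ρ : ℝ) (T : Set ℝ) {P : ℕ}
    (hP : 0 < P) :
    Set.univ.pi (splitAt d (Set.Ico 0 ρ) T : Fin k → Set ℝ) ⊆ ⋃ q ∈ Finset.Ioc 0 (P ^ d),
      Set.univ.pi (splitAt d (rationalNhd Set.univ lam ρ (1 / (q * P)) q) T) := by
  intro y hy
  obtain ⟨q, hq0, hqP, c, hc⟩ := exists_simultaneous_approx
    (fun j : Fin d => y (Fin.castLE hd j) / lam) hP
  rw [Fintype.card_fin] at hqP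
  refine Set.mem_biUnion (x := q) (Finset.mem_Ioc.2 ⟨hq0, hqP⟩) fun j hj => ?_
  have hyj := hy j hj
  by_cases hjd : (j : ℕ) < d
  · rw [splitAt_of_lt hjd] at hyj ⊢
    exact ⟨hyj, c ⟨j, hjd⟩, trivial, hc ⟨j, hjd⟩⟩
  · rwa [splitAt_of_not_lt hjd] at hyj ⊢

theorem volume_pi_rationalNhd_le {k d : ℕ} (hd : d ≤ k) {lam ρ ρ' : ℝ} (hlam : 0 < lam)
    (hρ : lam ≤ ρ) (hρ' : 0 ≤ ρ') {q P : ℕ} (hq : 0 < q) (hP : 0 < P) :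
    volume (Set.univ.pi (splitAt d (rationalNhd Set.univ lam ρ (1 / (q * P)) q)
      (Set.Ico 0 ρ') : Fin k → Set ℝ)) ≤
      ENNReal.ofReal ((8 / P) ^ d * (ρ ^ d * ρ' ^ (k - d))) := by
  have hρ0 : 0 ≤ ρ := hlam.le.trans hρ
  have hq0 : (0 : ℝ) < q := Nat.cast_pos.2 hq
  have hnhd := volume_rationalNhd_le Set.univ (δ := 1 / (q * P)) hlam hρ hq (by positivity)
    (one_div_le_one_div_of_le hq0 (le_mul_of_one_le_right hq0.le (Nat.one_le_cast.2 hP)))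
  rw [show 8 * q * (1 / (q * P)) * ρ = 8 / P * ρ by field_simp] at hnhd
  rw [volume_pi_splitAt hd, ← mul_assoc, ← mul_pow, ENNReal.ofReal_mul (by positivity),
    ENNReal.ofReal_pow (by positivity), ENNReal.ofReal_pow hρ', Real.volume_Ico, sub_zero]
  gcongr

theorem half_le_volume_biUnion_goodDenoms {k d : ℕ} (hd : d ≤ k) {lam ρ ρ' : ℝ} (hlam : 0 < lam)
    (hρ : lam ≤ ρ) (hρ' : 0 ≤ ρ') {P : ℕ} (hP : 0 < P) :
    ENNReal.ofReal (ρ ^ d * ρ' ^ (k - d) / 2) ≤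
      volume (⋃ q ∈ goodDenoms (P ^ d) (1 / (4 * 8 ^ d)), Set.univ.pi (splitAt d
        (rationalNhd Set.univ lam ρ (1 / (q * P)) q) (Set.Ico 0 ρ') : Fin k → Set ℝ)) := by
  have hρ0 : 0 ≤ ρ := hlam.le.trans hρ
  set V : ℝ := ρ ^ d * ρ' ^ (k - d)
  set G := goodDenoms (P ^ d) (1 / (4 * 8 ^ d))
  have hbox : volume (Set.univ.pi (splitAt d (Set.Ico 0 ρ) (Set.Ico 0 ρ') : Fin k → Set ℝ)) =
      ENNReal.ofReal V := by
    rw [volume_pi_splitAt hd, Real.volume_Ico, Real.volume_Ico, sub_zero, sub_zero,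
      ← ENNReal.ofReal_pow hρ0, ← ENNReal.ofReal_pow hρ', ← ENNReal.ofReal_mul (by positivity)]
  have hslice : ∀ q ∈ Finset.Ioc 0 (P ^ d), volume (Set.univ.pi (splitAt d
      (rationalNhd Set.univ lam ρ (1 / (q * P)) q) (Set.Ico 0 ρ') : Fin k → Set ℝ)) ≤
      ENNReal.ofReal ((8 / P) ^ d * V) := fun q hq =>
    volume_pi_rationalNhd_le hd hlam hρ hρ' (Finset.mem_Ioc.1 hq).1 hP
  have hbad : ((Finset.Ioc 0 (P ^ d) \ G).card : ENNReal) * ENNReal.ofReal ((8 / P) ^ d * V) ≤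
      ENNReal.ofReal (V / 2) := by
    rw [← ENNReal.ofReal_natCast, ← ENNReal.ofReal_mul (Nat.cast_nonneg _)]
    refine ENNReal.ofReal_le_ofReal ?_
    have hcard := card_not_goodDenoms_le (P ^ d) (ε := 1 / (4 * 8 ^ d)) (by positivity)
    calc _ ≤ 2 * (1 / (4 * 8 ^ d)) * (P ^ d : ℕ) * ((8 / P) ^ d * V) := by gcongr
      _ = V / 2 := by
        rw [div_pow]
        push_cast
        field_simp
        norm_num
  have hcount := (measure_le_biUnion_add_card_mul volume _ G
    (pi_Ico_subset_biUnion_rationalNhd hd lam ρ _ hP) hslice).trans (add_le_add_right hbad _)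
  rw [hbox] at hcount
  rw [show V / 2 = V - V / 2 by ring, ENNReal.ofReal_sub _ (by positivity)]
  exact tsub_le_iff_right.2 hcount

end Covering

section Resonance

variable {k d : ℕ} {W r : ℝ} {F : ℝ → ℂ} {S : Set (Fin (k + 1) → ℝ)}

/-- The side of the box in which the exceptional set lies; `k + 1` such sides fit well inside
the unit ball. -/
noncomputable def boxSide (k : ℕ) : ℝ := 1 / (8 * (k + 1))

theorem boxSide_pos (k : ℕ) : 0 < boxSide k := by
  rw [boxSide]
  positivity

theorem succ_mul_boxSide (k : ℕ) : (k + 1) * boxSide k = 1 / 8 := by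
  rw [boxSide]
  field_simp

theorem boxSide_le (k : ℕ) : boxSide k ≤ 1 / 8 := by
  nlinarith [succ_mul_boxSide k, boxSide_pos k, Nat.cast_nonneg (α := ℝ) k]

/-- The box containing the exceptional set at frequency scale `R = W ^ 2`: the last `k - d`
coordinates are confined to `|x_j| ≲ R ^ (-1/2)`, where a bump of width `√R` does not disperse. -/
def spaceBox (k d : ℕ) (W : ℝ) : Set (Fin (k + 1) → ℝ) :=
  Set.univ.pi (blocks d (Set.Ico 0 (boxSide k)) (Set.Ico 0 (boxSide k)) (Set.Ico 0 (boxSide k / W)))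

theorem measurableSet_spaceBox (k d : ℕ) (W : ℝ) : MeasurableSet (spaceBox k d W) :=
  .univ_pi (forall_blocks measurableSet_Ico measurableSet_Ico measurableSet_Ico)

theorem volume_spaceBox (hd : d ≤ k) (hW : 0 ≤ W) :
    volume (spaceBox k d W) = ENNReal.ofReal (boxSide k ^ (k + 1) * (1 / W) ^ (k - d)) := by
  have hρ := (boxSide_pos k).le
  obtain ⟨e, rfl⟩ := Nat.exists_eq_add_of_le hd
  simp only [spaceBox, volume_pi_blocks hd, Real.volume_Ico, sub_zero, Nat.add_sub_cancel_left]
  rw [← ENNReal.ofReal_pow hρ, ← ENNReal.ofReal_pow (by positivity),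
    ← ENNReal.ofReal_mul (by positivity), ← ENNReal.ofReal_mul hρ]
  congr 1
  simp only [div_eq_mul_inv, one_mul, mul_pow]
  ring

theorem mem_Ico_boxSide_of_mem_spaceBox (hW : 1 ≤ W) {x : Fin (k + 1) → ℝ}
    (hx : x ∈ spaceBox k d W) (j : Fin (k + 1)) : x j ∈ Set.Ico 0 (boxSide k) :=
  forall_blocks (p := (· ⊆ Set.Ico 0 (boxSide k))) subset_rfl subset_rfl
    (Set.Ico_subset_Ico_right (div_le_self (boxSide_pos k).le hW)) j (hx j trivial)

theorem norm_le_sum_abs {n : ℕ} (x : EuclideanSpace ℝ (Fin n)) : ‖x‖ ≤ ∑ j, |x j| := by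
  rw [EuclideanSpace.norm_eq]
  refine Real.sqrt_le_iff.2 ⟨Finset.sum_nonneg fun _ _ => abs_nonneg _, ?_⟩
  simp only [Real.norm_eq_abs]
  exact Finset.sum_sq_le_sq_sum_of_nonneg fun _ _ => abs_nonneg _

theorem ofLp_preimage_spaceBox_subset_ball (hW : 1 ≤ W) :
    (fun x : EuclideanSpace ℝ (Fin (k + 1)) => x.ofLp) ⁻¹' spaceBox k d W ⊆ Metric.ball 0 1 := by
  intro x hx
  rw [mem_ball_zero_iff]
  calc ‖x‖ ≤ ∑ j, |x j| := norm_le_sum_abs x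
    _ ≤ ∑ _j : Fin (k + 1), boxSide k := Finset.sum_le_sum fun j _ => by
      have hj := mem_Ico_boxSide_of_mem_spaceBox hW hx j
      rw [abs_of_nonneg hj.1]
      exact hj.2.le
    _ = 1 / 8 := by simp [succ_mul_boxSide]
    _ < 1 := by norm_num

/-- The one-dimensional datum `F` resonates on `S` with ratio `r`, at frequency scale
`R = W ^ 2`: to each point of `S` there is a time, within `O(R ^ (-3/2))` of the moment at which
a packet of frequency `R` in the first coordinate passes through it, such that the evolution of
`F` is large at each of the next `d` coordinates. -/
structure IsResonant (d : ℕ) (W r : ℝ) (F : ℝ → ℂ) (S : Set (Fin (k + 1) → ℝ)) : Prop where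
  memLp : MemLp F 2 volume
  integral_norm_sq_pos : 0 < ∫ s, ‖F s‖ ^ 2
  abs_le_of_ne_zero : ∀ s, F s ≠ 0 → |s| ≤ 2 * W ^ 2
  measurableSet : MeasurableSet S
  subset_spaceBox : S ⊆ spaceBox k d W
  exists_time : ∀ x ∈ S, ∃ t : ℝ, W * |x 0 + 2 * t * W ^ 2| ≤ 1 / 8 ∧
    ∀ j : Fin k, (j : ℕ) < d → r * √(∫ s, ‖F s‖ ^ 2) ≤ ‖evolution F t (x j.succ)‖

theorem IsResonant.mono (h : IsResonant d W r F S) {r' : ℝ} (hr : r' ≤ r) :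
    IsResonant d W r' F S where
  __ := h
  exists_time x hx := by
    obtain ⟨t, ht, hres⟩ := h.exists_time x hx
    refine ⟨t, ht, fun j hj => le_trans ?_ (hres j hj)⟩
    gcongr

theorem abs_sub_div_le_of_mul_abs_le {a t : ℝ} (hW : 0 < W)
    (h : W * |a + 2 * t * W ^ 2| ≤ 1 / 8) : |t - -a / (2 * W ^ 2)| ≤ 1 / W ^ 3 := by
  rw [show t - -a / (2 * W ^ 2) = (a + 2 * t * W ^ 2) / (2 * W ^ 2) by field_simp; ring, abs_div,
    abs_of_pos (by positivity : 0 < 2 * W ^ 2), div_le_div_iff₀ (by positivity) (by positivity)]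
  nlinarith [mul_le_mul_of_nonneg_left h (sq_nonneg W), sq_nonneg W]

theorem abs_mul_sq_le_of_mul_abs_le {a t : ℝ} (hW : 1 ≤ W) (ha : |a| ≤ 1 / 8)
    (h : W * |a + 2 * t * W ^ 2| ≤ 1 / 8) : |t| * W ^ 2 ≤ 1 / 8 := by
  have h' := (le_mul_of_one_le_left (abs_nonneg _) hW).trans h
  rw [← abs_of_nonneg (sq_nonneg W), ← abs_mul, abs_le]
  rw [abs_le] at ha h'
  constructor <;> linarith

/-- The Fourier factors of the datum. -/
noncomputable def datumFactor (d : ℕ) (W : ℝ) (F : ℝ → ℂ) : Fin (k + 1) → ℝ → ℂ :=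
  blocks d (intervalBump (W ^ 2) W) F (intervalBump 0 W)

theorem norm_mem_Icc_of_prod_datumFactor_ne_zero (hW : 1 ≤ W)
    (hF : ∀ s, F s ≠ 0 → |s| ≤ 2 * W ^ 2) {ξ : EuclideanSpace ℝ (Fin (k + 1))}
    (hξ : ∏ j, datumFactor d W F j (ξ j) ≠ 0) : ‖ξ‖ ∈ Set.Icc (W ^ 2) (2 * (k + 1) * W ^ 2) := by
  rw [Finset.prod_ne_zero_iff] at hξ
  have hWsq : W ≤ W ^ 2 := le_self_pow₀ hW two_ne_zero
  have hcarrier : ξ 0 ∈ Set.Ioc (W ^ 2) (W ^ 2 + W) :=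
    Set.mem_of_indicator_ne_zero (hξ 0 (Finset.mem_univ _))
  have hbump {b : ℝ} (hb : 0 ≤ b) (hb' : b ≤ W ^ 2) (s : ℝ) (hs : intervalBump b W s ≠ 0) :
      |s| ≤ 2 * W ^ 2 := by
    have := Set.mem_of_indicator_ne_zero hs
    rw [abs_le]
    constructor <;> linarith [this.1, this.2]
  have hcoord (j : Fin (k + 1)) : |ξ j| ≤ 2 * W ^ 2 :=
    forall_blocks (p := fun G : ℝ → ℂ => ∀ s, G s ≠ 0 → |s| ≤ 2 * W ^ 2)
      (hbump (sq_nonneg W) le_rfl) hF (hbump le_rfl (sq_nonneg W)) j _ (hξ j (Finset.mem_univ _))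
  constructor
  · calc W ^ 2 ≤ |ξ 0| := hcarrier.1.le.trans (le_abs_self _)
      _ ≤ ‖ξ‖ := by simpa using PiLp.norm_apply_le ξ 0
  · calc ‖ξ‖ ≤ ∑ j, |ξ j| := norm_le_sum_abs ξ
      _ ≤ ∑ _j : Fin (k + 1), 2 * W ^ 2 := Finset.sum_le_sum fun j _ => hcoord j
      _ = 2 * (k + 1) * W ^ 2 := by
        rw [Finset.sum_const, Finset.card_univ, Fintype.card_fin, nsmul_eq_mul]
        push_cast
        ring

theorem sqrt_half_mul_le_norm_evolution_intervalBump {x t b : ℝ} (hW : 0 ≤ W)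
    (h : W * |x + 2 * t * b| + |t| * W ^ 2 ≤ 1 / 2) :
    √W / 2 * √(∫ s, ‖intervalBump b W s‖ ^ 2) ≤ ‖evolution (intervalBump b W) t x‖ := by
  rw [integral_norm_sq_intervalBump b hW, div_mul_eq_mul_div, Real.mul_self_sqrt hW]
  exact half_le_norm_evolution_intervalBump hW h

theorem IsResonant.exists_time_evolution_datumFactor (h : IsResonant d W r F S) (hW : 1 ≤ W)
    {x : Fin (k + 1) → ℝ} (hx : x ∈ S) :
    ∃ t : ℝ, |t - -x 0 / (2 * W ^ 2)| ≤ 1 / W ^ 3 ∧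
      ∀ j, blocks d (√W / 2) r (√W / 2) j * √(∫ s, ‖datumFactor d W F j s‖ ^ 2) ≤
        ‖evolution (datumFactor d W F j) t (x j)‖ := by
  obtain ⟨t, ht, hres⟩ := h.exists_time x hx
  have hbox := h.subset_spaceBox hx
  have hW0 : 0 < W := zero_lt_one.trans_le hW
  have hx0 := mem_Ico_boxSide_of_mem_spaceBox hW hbox 0
  have htW : |t| * W ^ 2 ≤ 1 / 8 := abs_mul_sq_le_of_mul_abs_le hW
    (by rw [abs_of_nonneg hx0.1]; exact hx0.2.le.trans (boxSide_le k)) ht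
  refine ⟨t, abs_sub_div_le_of_mul_abs_le hW0 ht, Fin.cases ?_ fun j => ?_⟩
  · exact sqrt_half_mul_le_norm_evolution_intervalBump hW0.le (by linarith)
  · have hxj := hbox j.succ trivial
    simp only [datumFactor, blocks_succ] at hxj ⊢
    by_cases hj : (j : ℕ) < d
    · simpa only [splitAt_of_lt hj] using hres j hj
    · simp only [splitAt_of_not_lt hj] at hxj ⊢
      refine sqrt_half_mul_le_norm_evolution_intervalBump hW0.le ?_
      have hWx : W * x j.succ ≤ boxSide k := by
        rw [← le_div_iff₀' hW0]
        exact hxj.2.le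
      rw [mul_zero, add_zero, abs_of_nonneg hxj.1]
      linarith [boxSide_le k]

theorem IsResonant.exists_datum (h : IsResonant d W r F S) (hd : d ≤ k) (hW : 1 ≤ W)
    (hr : 0 ≤ r) :
    ∃ f : Lp (α := EuclideanSpace ℝ (Fin (k + 1))) ℂ 2 volume, f ≠ 0 ∧
      (∀ᵐ ξ, ‖ξ‖ ∉ Set.Icc (W ^ 2) (2 * (k + 1) * W ^ 2) → unitaryFourier f ξ = 0) ∧
      ∀ x : EuclideanSpace ℝ (Fin (k + 1)), x.ofLp ∈ S → ∃ t : ℝ,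
        |t - -x 0 / (2 * W ^ 2)| ≤ 1 / W ^ 3 ∧
        (2 * Real.pi) ^ (-((k + 1 : ℕ) : ℝ) / 2) * (√W / 2 * (r ^ d * (√W / 2) ^ (k - d))) ≤
          ‖schrodinger t f x‖ / ‖f‖ := by
  have hbump (b : ℝ) : 0 < ∫ s, ‖intervalBump b W s‖ ^ 2 := by
    rw [integral_norm_sq_intervalBump b (zero_le_one.trans hW)]
    exact zero_lt_one.trans_le hW
  have hmem : ∀ j : Fin (k + 1), MemLp (datumFactor d W F j) 2 volume :=
    forall_blocks (p := fun G : ℝ → ℂ => MemLp G 2 volume) (memLp_intervalBump _ _ _) h.memLp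
      (memLp_intervalBump _ _ _)
  have hpos : ∀ j : Fin (k + 1), 0 < ∫ s, ‖datumFactor d W F j s‖ ^ 2 :=
    forall_blocks (p := fun G : ℝ → ℂ => 0 < ∫ s, ‖G s‖ ^ 2) (hbump _) h.integral_norm_sq_pos
      (hbump _)
  obtain ⟨f, hf, hnorm⟩ := exists_tensor_datum hmem
  refine ⟨f, ?_, ?_, fun x hx => ?_⟩
  · rw [← norm_pos_iff, hnorm]
    exact Finset.prod_pos fun j _ => Real.sqrt_pos.2 (hpos j)
  · filter_upwards [hf] with ξ hξ hout
    rw [hξ]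
    by_contra hne
    exact hout (norm_mem_Icc_of_prod_datumFactor_ne_zero hW h.abs_le_of_ne_zero hne)
  · obtain ⟨t, ht, hlow⟩ := h.exists_time_evolution_datumFactor hW hx
    refine ⟨t, ht, ?_⟩
    have hr' : ∀ j : Fin (k + 1), 0 ≤ blocks d (√W / 2) r (√W / 2) j :=
      forall_blocks (by positivity) hr (by positivity)
    simpa only [prod_blocks hd] using mul_prod_le_norm_schrodinger_div_norm hf hnorm hpos hr' hlow

theorem IsResonant.volume_real_le (h : IsResonant d W r F S) (hd : d ≤ k) (hW : 0 ≤ W) :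
    volume.real S ≤ (1 / W) ^ (k - d) := by
  have hbox := (measure_mono h.subset_spaceBox).trans_eq (volume_spaceBox hd hW)
  refine (ENNReal.toReal_mono ENNReal.ofReal_ne_top hbox).trans ?_
  rw [ENNReal.toReal_ofReal (mul_nonneg (pow_nonneg (boxSide_pos k).le _) (by positivity))]
  exact mul_le_of_le_one_left (by positivity)
    (pow_le_one₀ (boxSide_pos k).le ((boxSide_le k).trans (by norm_num)))

theorem IsResonant.le_volume_real (h : IsResonant d W r F S) (hd : d ≤ k) (hW : 0 ≤ W) {v : ℝ}
    (hv : ENNReal.ofReal v ≤ volume S) : v ≤ volume.real S := by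
  have hbox := (measure_mono h.subset_spaceBox).trans_eq (volume_spaceBox hd hW)
  exact (ENNReal.ofReal_le_iff_le_toReal (ne_top_of_le_ne_top ENNReal.ofReal_ne_top hbox)).1 hv

theorem volume_real_ofLp_preimage (hS : MeasurableSet S) :
    volume.real ((fun x : EuclideanSpace ℝ (Fin (k + 1)) => x.ofLp) ⁻¹' S) = volume.real S :=
  congrArg ENNReal.toReal
    ((PiLp.volume_preserving_ofLp (Fin (k + 1))).measure_preimage hS.nullMeasurableSet)

end Resonance

section Bump

variable {k d : ℕ} {W : ℝ}

theorem isResonant_intervalBump (hW : 1 ≤ W) :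
    IsResonant d W (1 / 2) (intervalBump 0 1) (spaceBox k d W) where
  memLp := memLp_intervalBump 0 1 2
  integral_norm_sq_pos := by
    rw [integral_norm_sq_intervalBump 0 zero_le_one]
    exact one_pos
  abs_le_of_ne_zero s hs := by
    have hs' : s ∈ Set.Ioc (0 : ℝ) (0 + 1) := Set.mem_of_indicator_ne_zero hs
    rw [abs_of_pos hs'.1]
    linarith [hs'.2, one_le_pow₀ (n := 2) hW]
  measurableSet := measurableSet_spaceBox k d W
  subset_spaceBox := subset_rfl
  exists_time x hx := by
    have hx0 := mem_Ico_boxSide_of_mem_spaceBox hW hx 0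
    have hρ := boxSide_le k
    have hfocus : W * |x 0 + 2 * (-x 0 / (2 * W ^ 2)) * W ^ 2| ≤ 1 / 8 := by
      rw [show x 0 + 2 * (-x 0 / (2 * W ^ 2)) * W ^ 2 = 0 by field_simp; ring, abs_zero, mul_zero]
      norm_num
    refine ⟨-x 0 / (2 * W ^ 2), hfocus, fun j _ => ?_⟩
    have hxj := mem_Ico_boxSide_of_mem_spaceBox hW hx j.succ
    have htW := abs_mul_sq_le_of_mul_abs_le hW
      (by rw [abs_of_nonneg hx0.1]; exact hx0.2.le.trans hρ) hfocus
    have ht := (le_mul_of_one_le_right (abs_nonneg _) (one_le_pow₀ (n := 2) hW)).trans htW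
    rw [integral_norm_sq_intervalBump 0 zero_le_one, Real.sqrt_one, mul_one]
    refine half_le_norm_evolution_intervalBump zero_le_one ?_
    rw [mul_zero, add_zero, abs_of_nonneg hxj.1]
    linarith [hxj.2]

end Bump

section Comb

variable {k d : ℕ} {W D : ℝ} {N P : ℕ}

theorem abs_le_of_fejerComb_ne_zero {M : ℕ} {D s : ℝ} (hD : 0 ≤ D) (h : fejerComb M D s ≠ 0) :
    |s| ≤ D * M + 1 := by
  obtain ⟨k, hk, hk'⟩ := Finset.exists_ne_zero_of_sum_ne_zero h
  obtain ⟨l, hl, hl'⟩ := Finset.exists_ne_zero_of_sum_ne_zero hk'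
  have hs := Set.mem_of_indicator_ne_zero hl'
  have hk : (k : ℝ) ≤ M := by exact_mod_cast (Finset.mem_range.1 hk).le
  have hl : (l : ℝ) ≤ M := by exact_mod_cast (Finset.mem_range.1 hl).le
  have hupper : D * ((k : ℝ) - l) ≤ D * M := by gcongr; linarith [Nat.cast_nonneg (α := ℝ) l]
  have hlower : D * (-M) ≤ D * ((k : ℝ) - l) := by gcongr; linarith [Nat.cast_nonneg (α := ℝ) k]
  rw [abs_le]
  constructor <;> linarith [hs.1, hs.2]

/-- The points whose first coordinate is close to an admissible rational multiple `a / q` of the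
period of the comb, and whose next `d` coordinates are close to rational multiples of its spatial
period with the same denominator `q`. -/
noncomputable def resonantSet (k d : ℕ) (W D : ℝ) (P : ℕ) : Set (Fin (k + 1) → ℝ) :=
  ⋃ q ∈ goodDenoms (P ^ d) (1 / (4 * 8 ^ d)), Set.univ.pi (blocks d
    (rationalNhd (gaussNumerators q) (2 * Real.pi * W ^ 2 / D ^ 2) (boxSide k) (1 / q) q)
    (rationalNhd Set.univ (2 * Real.pi / D) (boxSide k) (1 / (q * P)) q)
    (Set.Ico 0 (boxSide k / W)))

theorem measurableSet_resonantSet (k d : ℕ) (W D : ℝ) (P : ℕ) :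
    MeasurableSet (resonantSet k d W D P) :=
  Finset.measurableSet_biUnion _ fun _ _ => .univ_pi <| forall_blocks
    (measurableSet_rationalNhd _ _ _ _ _) (measurableSet_rationalNhd _ _ _ _ _) measurableSet_Ico

theorem resonantSet_subset_spaceBox (k d : ℕ) (W D : ℝ) (P : ℕ) :
    resonantSet k d W D P ⊆ spaceBox k d W := by
  refine Set.iUnion₂_subset fun q _ => Set.pi_mono fun j _ => ?_
  refine Fin.cases Set.inter_subset_left (fun j => ?_) j
  simp only [blocks_succ, splitAt]
  split_ifs
  exacts [Set.inter_subset_left, subset_rfl]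

/-- The comb of spacing `D` with `N * P ^ d` teeth fits in the frequency ball of radius `W ^ 2`,
and on `resonantSet k d W D P` its evolution stays close to a complete Gauss sum. -/
structure IsAdmissible (k d : ℕ) (W D : ℝ) (N P : ℕ) : Prop where
  one_le_spacing : 1 ≤ D
  sixteen_le : 16 ≤ N
  time_period_le : 2 * (2 * Real.pi * W ^ 2 / D ^ 2) ≤ boxSide k
  space_period_le : 2 * Real.pi / D ≤ boxSide k
  time_resolution : W * (2 * Real.pi * W ^ 2 / D ^ 2) ≤ 1 / (4 * 8 ^ d) * (P : ℝ) ^ d / 8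
  space_resolution : 2 * Real.pi * N ≤ 1 / (4 * 8 ^ d) * P / 128
  bandwidth_le : D * (N * P ^ d) ≤ W ^ 2 / 32

namespace IsAdmissible

theorem pos (h : IsAdmissible k d W D N P) : 0 < P := by
  have hN : (16 : ℝ) ≤ N := by exact_mod_cast h.sixteen_le
  have hP : 0 < 1 / (4 * 8 ^ d) * (P : ℝ) / 128 :=
    (mul_pos Real.two_pi_pos (by linarith)).trans_le h.space_resolution
  by_contra! hP0
  rw [Nat.le_zero.1 hP0, Nat.cast_zero, mul_zero, zero_div] at hP
  exact lt_irrefl _ hP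

theorem le_volume_resonantSet (h : IsAdmissible k d W D N P) (hd : d ≤ k) (hW : 0 < W) :
    ENNReal.ofReal (Real.exp (-2 * (4 * 8 ^ d)) * boxSide k ^ (k + 1) / 8 * (1 / W) ^ (k - d)) ≤
      volume (resonantSet k d W D P) := by
  have hρ := boxSide_pos k
  have hD : 0 < D := zero_lt_one.trans_le h.one_le_spacing
  set η : ℝ := Real.exp (-2 * (4 * 8 ^ d))
  have hfirst : ∀ q ∈ goodDenoms (P ^ d) (1 / (4 * 8 ^ d)), ENNReal.ofReal (η * boxSide k / 4) ≤
      volume (rationalNhd (gaussNumerators q) (2 * Real.pi * W ^ 2 / D ^ 2) (boxSide k)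
        (1 / q) q) := fun q hq =>
    le_volume_rationalNhd_gaussNumerators (by positivity) h.time_period_le (mem_goodDenoms.1 hq).1.1
      (by simpa only [one_div_one_div] using exp_mul_le_totient_of_mem_goodDenoms hq)
  refine le_trans ?_ (mul_volume_biUnion_le_pi_cons _
    (fun q => measurableSet_rationalNhd _ _ _ _ _) (fun q => forall_splitAt
      (measurableSet_rationalNhd _ _ _ _ _) measurableSet_Ico) hfirst)
  refine le_trans ?_ (mul_le_mul_right (half_le_volume_biUnion_goodDenoms hd (by positivity)
    h.space_period_le (by positivity) h.pos) _)
  rw [← ENNReal.ofReal_mul (by positivity)]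
  refine ENNReal.ofReal_le_ofReal (le_of_eq ?_)
  obtain ⟨e, rfl⟩ := Nat.exists_eq_add_of_le hd
  rw [Nat.add_sub_cancel_left]
  simp only [div_eq_mul_inv, one_mul, mul_pow]
  ring

theorem mul_abs_le_of_near_rational (h : IsAdmissible k d W D N P) (hW : 0 < W) {x : ℝ} {a : ℤ}
    {q : ℕ} (hq : q ∈ goodDenoms (P ^ d) (1 / (4 * 8 ^ d)))
    (ha : |x / (2 * Real.pi * W ^ 2 / D ^ 2) - (a : ℝ) / q| ≤ (1 : ℝ) / q) :
    W * |x + 2 * -(Real.pi * a / (q * D ^ 2)) * W ^ 2| ≤ 1 / 8 := by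
  have hD : 0 < D := zero_lt_one.trans_le h.one_le_spacing
  obtain ⟨⟨hq0, -⟩, hq, -⟩ := mem_goodDenoms.1 hq
  have hq0 : (0 : ℝ) < q := Nat.cast_pos.2 hq0
  have hres := h.time_resolution
  push_cast at hq
  set lam : ℝ := 2 * Real.pi * W ^ 2 / D ^ 2 with hlam
  have hlam0 : 0 < lam := by positivity
  have hx : x + 2 * -(Real.pi * a / (q * D ^ 2)) * W ^ 2 = lam * (x / lam - a / q) := by
    rw [mul_sub, mul_div_cancel₀ _ hlam0.ne', hlam]
    field_simp
    ring
  rw [hx, abs_mul, abs_of_pos hlam0]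
  calc W * (lam * |x / lam - a / q|) ≤ W * (lam * (1 / q)) := by gcongr
    _ = W * lam / q := by ring
    _ ≤ 1 / 8 := by
      rw [div_le_iff₀ hq0]
      linarith

theorem mul_add_le_of_near_rational (h : IsAdmissible k d W D N P) {x t : ℝ} {c : ℤ} {q : ℕ}
    (hq : q ∈ goodDenoms (P ^ d) (1 / (4 * 8 ^ d))) (ht : |t| * W ^ 2 ≤ 1 / 8)
    (hc : |x / (2 * Real.pi / D) - c / q| ≤ 1 / (q * P)) :
    N * P ^ d * (|D * x - 2 * Real.pi * c / q| + 2 * D * |t|) ≤ 1 / 64 := by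
  have hP : (0 : ℝ) < P := Nat.cast_pos.2 h.pos
  obtain ⟨⟨hq0, -⟩, hq, -⟩ := mem_goodDenoms.1 hq
  have hq0 : (0 : ℝ) < q := Nat.cast_pos.2 hq0
  push_cast at hq
  have hphase : N * P ^ d * |D * x - 2 * Real.pi * c / q| ≤ 1 / 128 := by
    rw [show D * x - 2 * Real.pi * c / q = 2 * Real.pi * (x / (2 * Real.pi / D) - c / q) by
      field_simp, abs_mul, abs_of_pos Real.two_pi_pos]
    calc N * P ^ d * (2 * Real.pi * |x / (2 * Real.pi / D) - c / q|)
        ≤ N * P ^ d * (2 * Real.pi * (1 / (q * P))) := by gcongr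
      _ = 2 * Real.pi * N * (P ^ d / (q * P)) := by ring
      _ ≤ 1 / (4 * 8 ^ d) * P / 128 * (P ^ d / (q * P)) := by gcongr; exact h.space_resolution
      _ = 1 / (4 * 8 ^ d) * P ^ d / q / 128 := by field_simp
      _ ≤ 1 / 128 := by
        gcongr
        exact (div_le_one hq0).2 hq
  have hdrift : N * P ^ d * (2 * D * |t|) ≤ 1 / 128 := by
    calc N * P ^ d * (2 * D * |t|) = 2 * (D * (N * P ^ d)) * |t| := by ring
      _ ≤ 2 * (W ^ 2 / 32) * |t| := by gcongr; exact h.bandwidth_le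
      _ = |t| * W ^ 2 / 16 := by ring
      _ ≤ 1 / 128 := by linarith
  rw [mul_add]
  linarith

theorem sqrt_half_mul_le_norm_evolution (h : IsAdmissible k d W D N P) (hW : 1 ≤ W) {q : ℕ}
    (hq : q ∈ goodDenoms (P ^ d) (1 / (4 * 8 ^ d))) {a : ℤ} (ha : a ∈ gaussNumerators q)
    (htW : |-(Real.pi * a / (q * D ^ 2))| * W ^ 2 ≤ 1 / 8) {x : ℝ}
    (hx : x ∈ rationalNhd Set.univ (2 * Real.pi / D) (boxSide k) (1 / (q * P)) q) :
    √N / 2 * √(∫ s, ‖fejerComb (N * P ^ d) D s‖ ^ 2) ≤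
      ‖evolution (fejerComb (N * P ^ d) D) (-(Real.pi * a / (q * D ^ 2))) x‖ := by
  have hD : 0 < D := zero_lt_one.trans_le h.one_le_spacing
  obtain ⟨⟨hq0, hqP⟩, -⟩ := mem_goodDenoms.1 hq
  obtain ⟨⟨hx0, hxρ⟩, c, -, hc⟩ := hx
  have hq0' : (0 : ℝ) < q := Nat.cast_pos.2 hq0
  have hqP' : (q : ℝ) ≤ (P : ℝ) ^ d := by exact_mod_cast hqP
  have : NeZero q := ⟨hq0.ne'⟩
  have ht := (le_mul_of_one_le_right (abs_nonneg _) (one_le_pow₀ (n := 2) hW)).trans htW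
  have hM : ((N * P ^ d : ℕ) : ℝ) = N * P ^ d := by push_cast; ring
  have hcomb := le_norm_evolution_fejerComb (a := -a) (c := c) (M := N * P ^ d) (x := x)
    (t := -(Real.pi * a / (q * D ^ 2))) (by rw [neg_mul]; exact ha.2.neg)
    (by push_cast; exact ha.1.neg) hD.le (by push_cast; field_simp)
    (by rw [abs_of_nonneg hx0]; linarith [boxSide_le k])
    (Nat.mul_le_mul h.sixteen_le hqP) (by rw [hM]; exact h.mul_add_le_of_near_rational hq htW hc)
  refine le_trans ?_ hcomb
  calc √N / 2 * √(∫ s, ‖fejerComb (N * P ^ d) D s‖ ^ 2)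
      ≤ √N / 2 * √(((N * P ^ d : ℕ) : ℝ) ^ 3) := by
        gcongr
        exact integral_norm_sq_fejerComb_le _ h.one_le_spacing
    _ = ((N * P ^ d : ℕ) : ℝ) ^ 2 / (2 * √((P : ℝ) ^ d)) := by
        have hP : 0 < √((P : ℝ) ^ d) := Real.sqrt_pos.2 (hq0'.trans_le hqP')
        rw [pow_succ, Real.sqrt_mul (by positivity), Real.sqrt_sq (by positivity), hM,
          Real.sqrt_mul (by positivity)]
        field_simp
        rw [Real.sq_sqrt (by positivity), Real.sq_sqrt (by positivity)]
        ring
    _ ≤ ((N * P ^ d : ℕ) : ℝ) ^ 2 / (2 * √q) := by gcongr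

theorem exists_time (h : IsAdmissible k d W D N P) (hW : 1 ≤ W) {x : Fin (k + 1) → ℝ}
    (hx : x ∈ resonantSet k d W D P) :
    ∃ t : ℝ, W * |x 0 + 2 * t * W ^ 2| ≤ 1 / 8 ∧
      ∀ j : Fin k, (j : ℕ) < d → √N / 2 * √(∫ s, ‖fejerComb (N * P ^ d) D s‖ ^ 2) ≤
        ‖evolution (fejerComb (N * P ^ d) D) t (x j.succ)‖ := by
  obtain ⟨q, hq, hx⟩ := Set.mem_iUnion₂.1 hx
  obtain ⟨⟨hx0, hxρ⟩, a, ha, hxa⟩ := hx 0 trivial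
  have hfocus := h.mul_abs_le_of_near_rational (zero_lt_one.trans_le hW) hq hxa
  refine ⟨_, hfocus, fun j hj => ?_⟩
  have hxj := hx j.succ trivial
  rw [blocks_succ, splitAt_of_lt hj] at hxj
  exact h.sqrt_half_mul_le_norm_evolution hW hq ha (abs_mul_sq_le_of_mul_abs_le hW
    (by rw [abs_of_nonneg hx0]; exact hxρ.le.trans (boxSide_le k)) hfocus) hxj

theorem isResonant (h : IsAdmissible k d W D N P) (hW : 1 ≤ W) :
    IsResonant d W (√N / 2) (fejerComb (N * P ^ d) D) (resonantSet k d W D P) where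
  memLp := memLp_fejerComb _ D 2
  integral_norm_sq_pos := by
    have hM : N * P ^ d ≠ 0 :=
      mul_ne_zero (by linarith [h.sixteen_le]) (pow_ne_zero d h.pos.ne')
    refine integral_norm_sq_pos (memLp_fejerComb _ D 2) ?_
    rw [integral_fejerComb]
    exact pow_ne_zero 2 (Nat.cast_ne_zero.2 hM)
  abs_le_of_ne_zero s hs := by
    have hs' := abs_le_of_fejerComb_ne_zero (zero_le_one.trans h.one_le_spacing) hs
    push_cast at hs'
    linarith [h.bandwidth_le, one_le_pow₀ (n := 2) hW]
  measurableSet := measurableSet_resonantSet k d W D P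
  subset_spaceBox := resonantSet_subset_spaceBox k d W D P
  exists_time _ hx := h.exists_time hW hx

end IsAdmissible

end Comb

section Parameters

variable {k d : ℕ}

/-- The ratio between the Dirichlet parameter `P` and the number `N` of teeth per residue. -/
def denomRatio (k d : ℕ) : ℕ := 4096 * (k + 1) * 8 ^ d

/-- The spacing of the comb in units of `X ^ (d + 3)`, at frequency scale `X ^ (2 * d + 4)`. -/
def combSpacing (k d : ℕ) : ℝ := 64 * (k + 1) * 4 ^ d

theorem denomRatio_pos (k d : ℕ) : 0 < denomRatio k d := by
  unfold denomRatio
  positivity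

theorem le_combSpacing (k d : ℕ) : 64 * ((k : ℝ) + 1) ≤ combSpacing k d :=
  le_mul_of_one_le_right (by positivity) (one_le_pow₀ (by norm_num))

theorem mul_four_pow_le_combSpacing (k d : ℕ) : 64 * (4 : ℝ) ^ d ≤ combSpacing k d := by
  unfold combSpacing
  gcongr
  linarith [Nat.cast_nonneg (α := ℝ) k]

theorem one_le_combSpacing (k d : ℕ) : 1 ≤ combSpacing k d := by
  linarith [le_combSpacing k d, Nat.cast_nonneg (α := ℝ) k]

theorem time_period_eq {X : ℝ} (hX : 0 < X) :
    2 * Real.pi * (X ^ (d + 2)) ^ 2 / (combSpacing k d * X ^ (d + 3)) ^ 2 =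
      2 * Real.pi / (combSpacing k d * X) ^ 2 := by
  have hL := zero_lt_one.trans_le (one_le_combSpacing k d)
  field_simp
  ring

theorem time_resolution_le {X P : ℝ} (hX : 0 < X) (hP : 0 < P) (hXP : X ≤ 2 * P) :
    X ^ (d + 2) * (2 * Real.pi / (combSpacing k d * X) ^ 2) ≤ 1 / (4 * 8 ^ d) * P ^ d / 8 := by
  have hL := zero_lt_one.trans_le (one_le_combSpacing k d)
  calc X ^ (d + 2) * (2 * Real.pi / (combSpacing k d * X) ^ 2)
      = 2 * Real.pi * X ^ d / combSpacing k d ^ 2 := by field_simp; ring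
    _ ≤ 2 * 4 * (2 * P) ^ d / (64 * 4 ^ d) ^ 2 := by
      gcongr
      exacts [Real.pi_lt_four.le, mul_four_pow_le_combSpacing k d]
    _ = 1 / (512 * 8 ^ d) * P ^ d := by
      rw [mul_pow, mul_pow, ← pow_mul, mul_comm d 2, pow_mul,
        show ((4 : ℝ) ^ 2) ^ d = 2 ^ d * 8 ^ d by rw [← mul_pow]; norm_num]
      field_simp
      norm_num
    _ ≤ 1 / (4 * 8 ^ d) * P ^ d / 8 := by
      rw [mul_div_right_comm, div_div]
      gcongr ?_ * _
      gcongr 1 / ?_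
      linarith [pow_pos (by norm_num : (0 : ℝ) < 8) d]

theorem two_mul_time_period_le {X : ℝ} (hX : 1 ≤ X) :
    2 * (2 * Real.pi / (combSpacing k d * X) ^ 2) ≤ boxSide k := by
  have hL := le_combSpacing k d
  have hL0 := zero_le_one.trans (one_le_combSpacing k d)
  calc 2 * (2 * Real.pi / (combSpacing k d * X) ^ 2)
      ≤ 2 * (2 * 4 / (64 * ((k : ℝ) + 1) * 1) ^ 2) := by
        gcongr
        exact Real.pi_lt_four.le
    _ ≤ boxSide k := by
      rw [boxSide]
      field_simp
      linarith [Nat.cast_nonneg (α := ℝ) k]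

theorem space_period_le {X : ℝ} (hX : 1 ≤ X) (e : ℕ) :
    2 * Real.pi / (combSpacing k d * X ^ e) ≤ boxSide k := by
  have hL := le_combSpacing k d
  have hL0 := zero_le_one.trans (one_le_combSpacing k d)
  calc 2 * Real.pi / (combSpacing k d * X ^ e) ≤ 2 * 4 / (64 * ((k : ℝ) + 1) * 1) := by
        gcongr
        exacts [Real.pi_lt_four.le, one_le_pow₀ hX]
    _ = boxSide k := by
      rw [boxSide]
      field_simp
      norm_num

theorem space_resolution_le (k d N : ℕ) :
    2 * Real.pi * N ≤ 1 / (4 * 8 ^ d) * ((denomRatio k d * N : ℕ) : ℝ) / 128 := by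
  rw [denomRatio]
  push_cast
  calc 2 * Real.pi * N ≤ 8 * ((k : ℝ) + 1) * N := by
        gcongr ?_ * _
        linarith [Real.pi_lt_four, Nat.cast_nonneg (α := ℝ) k]
    _ = 1 / (4 * 8 ^ d) * (4096 * (k + 1) * 8 ^ d * N) / 128 := by
      field_simp
      ring

theorem mul_combSpacing_le_denomRatio (k d : ℕ) : 64 * combSpacing k d ≤ denomRatio k d := by
  rw [combSpacing, denomRatio]
  push_cast
  calc (64 : ℝ) * (64 * (k + 1) * 4 ^ d) = 4096 * (k + 1) * 4 ^ d := by ring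
    _ ≤ 4096 * (k + 1) * 8 ^ d := by gcongr; norm_num

theorem isAdmissible {X : ℝ} {N : ℕ} (hX : 1 ≤ X) (hN : 16 ≤ N) (hNX : denomRatio k d * N ≤ X)
    (hXN : X ≤ 2 * (denomRatio k d * N)) :
    IsAdmissible k d (X ^ (d + 2)) (combSpacing k d * X ^ (d + 3)) N (denomRatio k d * N) where
  one_le_spacing := one_le_mul_of_one_le_of_one_le (one_le_combSpacing k d) (one_le_pow₀ hX)
  sixteen_le := hN
  time_period_le := by
    rw [time_period_eq (zero_lt_one.trans_le hX)]
    exact two_mul_time_period_le hX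
  space_period_le := space_period_le hX _
  time_resolution := by
    have hX0 : 0 < X := zero_lt_one.trans_le hX
    rw [time_period_eq hX0]
    push_cast
    exact time_resolution_le hX0 (by linarith) hXN
  space_resolution := space_resolution_le k d N
  bandwidth_le := by
    push_cast
    calc combSpacing k d * X ^ (d + 3) * (N * (denomRatio k d * N) ^ d)
        ≤ denomRatio k d / 64 * X ^ (d + 3) * (N * X ^ d) := by
          gcongr
          linarith [mul_combSpacing_le_denomRatio k d]
      _ = denomRatio k d * N * X ^ (2 * d + 3) / 64 := by ring
      _ ≤ X * X ^ (2 * d + 3) / 64 := by gcongr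
      _ = (X ^ (d + 2)) ^ 2 / 64 := by ring
      _ ≤ (X ^ (d + 2)) ^ 2 / 32 := by gcongr; norm_num

theorem mul_sqrt_le_sqrt_div_two {K X : ℝ} (hK : 0 < K) {N : ℕ} (hX : X ≤ 16 * K * N) :
    1 / (8 * √K) * √X ≤ √N / 2 := by
  have hsqrt : √X ≤ 4 * √K * √N := by
    rw [Real.sqrt_le_left (by positivity), mul_pow, mul_pow, Real.sq_sqrt hK.le,
      Real.sq_sqrt N.cast_nonneg]
    linarith
  rw [one_div_mul_eq_div, div_le_iff₀ (by positivity)]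
  linarith

theorem exists_isResonant (hd : d ≤ k) : ∃ c v : ℝ, 0 < c ∧ 0 < v ∧ ∀ X : ℝ, 1 < X →
    ∃ (F : ℝ → ℂ) (S : Set (Fin (k + 1) → ℝ)), IsResonant d (X ^ (d + 2)) (c * √X) F S ∧
      ENNReal.ofReal (v * (1 / X ^ (d + 2)) ^ (k - d)) ≤ volume S := by
  have hρ := boxSide_pos k
  have hK0 : (0 : ℝ) < denomRatio k d := Nat.cast_pos.2 (denomRatio_pos k d)
  refine ⟨1 / (8 * √(denomRatio k d)), Real.exp (-2 * (4 * 8 ^ d)) * boxSide k ^ (k + 1) / 8,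
    by positivity, by positivity, fun X hX => ?_⟩
  have hW : 1 ≤ X ^ (d + 2) := one_le_pow₀ hX.le
  rcases lt_or_ge X (16 * denomRatio k d) with hsmall | hlarge
  · refine ⟨_, _, (isResonant_intervalBump hW).mono ?_, ?_⟩
    · simpa using mul_sqrt_le_sqrt_div_two hK0 (N := 1) (by simpa using hsmall.le)
    · rw [volume_spaceBox hd (zero_le_one.trans hW), mul_div_right_comm]
      gcongr
      refine mul_le_of_le_one_left (by positivity) ?_
      have hexp : Real.exp (-2 * (4 * 8 ^ d)) ≤ 1 :=
        Real.exp_le_one_iff.2 (by linarith [pow_pos (by norm_num : (0 : ℝ) < 8) d])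
      linarith
  · set N : ℕ := ⌊X / denomRatio k d⌋₊
    have hN16 : 16 ≤ N := Nat.le_floor (by rwa [Nat.cast_ofNat, le_div_iff₀ hK0])
    have hNX : denomRatio k d * N ≤ X := by
      rw [← le_div_iff₀' hK0]
      exact Nat.floor_le (by positivity)
    have hXN : X ≤ 2 * (denomRatio k d * N) := by
      have hlt := (div_lt_iff₀' hK0).1 (Nat.lt_floor_add_one (X / denomRatio k d))
      nlinarith
    have hadm := isAdmissible hX.le hN16 hNX hXN
    exact ⟨_, _, (hadm.isResonant hW).mono (mul_sqrt_le_sqrt_div_two hK0 (by nlinarith)),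
      hadm.le_volume_resonantSet hd (zero_lt_one.trans_le hW)⟩

end Parameters

section Exponents

theorem sq_rpow {W : ℝ} (hW : 0 ≤ W) (s : ℝ) : (W ^ 2) ^ s = W ^ (2 * s) := by
  rw [Real.rpow_mul hW, Real.rpow_two]

theorem sq_rpow_neg_natCast_div_two {W : ℝ} (hW : 0 ≤ W) (e : ℕ) :
    (W ^ 2) ^ (-(e : ℝ) / 2) = (1 / W) ^ e := by
  rw [sq_rpow hW, mul_div_cancel₀ _ two_ne_zero, Real.rpow_neg hW, Real.rpow_natCast, one_div,
    inv_pow]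

theorem sq_rpow_natCast_div_four {W : ℝ} (hW : 0 ≤ W) (e : ℕ) :
    (W ^ 2) ^ ((e : ℝ) / 4) = √W ^ e := by
  rw [sq_rpow hW, Real.sqrt_eq_rpow, ← Real.rpow_natCast, ← Real.rpow_mul hW]
  congr 1
  ring

theorem pow_sq_rpow_div {X : ℝ} (hX : 0 ≤ X) (m : ℕ) :
    ((X ^ (m + 1)) ^ 2) ^ ((m : ℝ) / (2 * (m + 1))) = X ^ m := by
  rw [← pow_mul, ← Real.rpow_natCast, ← Real.rpow_mul hX, ← Real.rpow_natCast X m]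
  congr 1
  push_cast
  field_simp

theorem exists_pow_sq_eq {R : ℝ} (hR : 1 < R) (m : ℕ) : ∃ X : ℝ, 1 < X ∧ (X ^ (m + 1)) ^ 2 = R := by
  refine ⟨R ^ ((((m + 1) * 2 : ℕ) : ℝ)⁻¹), Real.one_lt_rpow hR (by positivity), ?_⟩
  rw [← pow_mul]
  exact Real.rpow_inv_natCast_pow (zero_le_one.trans hR.le) (by positivity)

theorem sq_rpow_neg_three_div_two {W : ℝ} (hW : 0 ≤ W) :
    (W ^ 2) ^ (-(3 : ℝ) / 2) = 1 / W ^ 3 := by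
  simpa using sq_rpow_neg_natCast_div_two hW 3

theorem amplitude_eq {X : ℝ} (hX : 0 ≤ X) (c : ℝ) (d e : ℕ) :
    √(X ^ (d + 2)) / 2 * ((c * √X) ^ d * (√(X ^ (d + 2)) / 2) ^ e) =
      c ^ d / 2 ^ (e + 1) * (X ^ (d + 1) * √(X ^ (d + 2)) ^ e) := by
  have hpow : √(X ^ (d + 2)) * √X ^ d = X ^ (d + 1) := by
    obtain ⟨Y, hY, rfl⟩ : ∃ Y, 0 ≤ Y ∧ Y ^ 2 = X := ⟨√X, Real.sqrt_nonneg X, Real.sq_sqrt hX⟩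
    rw [pow_right_comm, Real.sqrt_sq (by positivity), Real.sqrt_sq hY]
    ring
  rw [← hpow]
  generalize √(X ^ (d + 2)) = w
  rw [mul_pow, div_pow, pow_succ 2 e]
  field_simp

end Exponents

theorem exists_datum_at_scale {k d : ℕ} (hd : d ≤ k) : ∃ v κ : ℝ, 0 < v ∧ 0 < κ ∧
    ∀ X : ℝ, 1 < X → ∀ W : ℝ, W = X ^ (d + 2) →
      ∃ f : Lp (α := EuclideanSpace ℝ (Fin (k + 1))) ℂ 2 volume, f ≠ 0 ∧
        (∀ᵐ ξ, ‖ξ‖ ∉ Set.Icc (W ^ 2) (2 * (k + 1) * W ^ 2) → unitaryFourier f ξ = 0) ∧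
        ∃ E : Set (EuclideanSpace ℝ (Fin (k + 1))), MeasurableSet E ∧ E ⊆ Metric.ball 0 1 ∧
          volume.real E ∈ Set.Icc (v * (1 / W) ^ (k - d)) ((1 / W) ^ (k - d)) ∧
          ∀ x ∈ E, ∃ t : ℝ, |t - -x 0 / (2 * W ^ 2)| ≤ 1 / W ^ 3 ∧
            κ * (X ^ (d + 1) * √W ^ (k - d)) ≤ ‖schrodinger t f x‖ / ‖f‖ := by
  obtain ⟨c, v, hc, hv, hres⟩ := exists_isResonant hd
  refine ⟨v, (2 * Real.pi) ^ (-((k + 1 : ℕ) : ℝ) / 2) * (c ^ d / 2 ^ (k - d + 1)), hv,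
    by positivity, ?_⟩
  rintro X hX _ rfl
  have hX0 : 0 < X := zero_lt_one.trans hX
  have hW : 1 ≤ X ^ (d + 2) := one_le_pow₀ hX.le
  have hW0 : 0 ≤ X ^ (d + 2) := zero_le_one.trans hW
  obtain ⟨F, S, h, hvol⟩ := hres X hX
  obtain ⟨f, hf, hsupp, hlow⟩ := h.exists_datum hd hW (by positivity)
  simp only [amplitude_eq hX0.le, ← mul_assoc] at hlow ⊢
  refine ⟨f, hf, hsupp, _, (PiLp.continuous_ofLp 2 _).measurable h.measurableSet,
    (Set.preimage_mono h.subset_spaceBox).trans (ofLp_preimage_spaceBox_subset_ball hW), ?_, hlow⟩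
  rw [volume_real_ofLp_preimage h.measurableSet]
  exact ⟨h.le_volume_real hd hW0 hvol, h.volume_real_le hd hW0⟩

theorem exists_ge_and_inv_le_and_inv_le (B : ℝ) {v κ : ℝ} (hv : 0 < v) (hκ : 0 < κ) :
    ∃ C : ℝ, B ≤ C ∧ C⁻¹ ≤ v ∧ C⁻¹ ≤ κ :=
  ⟨max B (max v⁻¹ κ⁻¹), le_max_left _ _,
    inv_le_of_inv_le₀ hv ((le_max_left _ _).trans (le_max_right _ _)),
    inv_le_of_inv_le₀ hκ ((le_max_right _ _).trans (le_max_right _ _))⟩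

theorem proposition2p1 (m n : ℕ) (hm : 1 ≤ m) (hmn : m ≤ n) :
    ∃ C : ℝ, 1 ≤ C ∧ ∀ R : ℝ, 1 < R →
      ∃ f : Lp (α := EuclideanSpace ℝ (Fin n)) ℂ 2 volume,
        f ≠ 0 ∧
        (∀ᵐ ξ : EuclideanSpace ℝ (Fin n),
          ¬ (C⁻¹ * R ≤ ‖ξ‖ ∧ ‖ξ‖ ≤ C * R) → unitaryFourier f ξ = 0) ∧
        ∃ E : Set (EuclideanSpace ℝ (Fin n)),
          MeasurableSet E ∧ E ⊆ Metric.ball 0 1 ∧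
          C⁻¹ * R ^ (-((n : ℝ) - m) / 2) ≤ volume.real E ∧
          volume.real E ≤ C * R ^ (-((n : ℝ) - m) / 2) ∧
          ∀ x ∈ E, ∃ t : ℝ,
            |t - (-(x ⟨0, by omega⟩) / (2 * R))| ≤ C * R ^ (-(3 : ℝ) / 2) ∧
            C⁻¹ * (R ^ ((m : ℝ) / (2 * (m + 1))) * R ^ (((n : ℝ) - m) / 4)) ≤
              ‖schrodinger t f x‖ / ‖f‖ := by
  obtain ⟨d, rfl⟩ := Nat.exists_eq_add_of_le' hm
  obtain ⟨k, rfl⟩ := Nat.exists_eq_add_of_le' (hm.trans hmn)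
  have hd : d ≤ k := Nat.le_of_succ_le_succ hmn
  obtain ⟨v, κ, hv, hκ, hdatum⟩ := exists_datum_at_scale hd
  obtain ⟨C, hCk, hCv, hCκ⟩ := exists_ge_and_inv_le_and_inv_le (2 * ((k : ℝ) + 1)) hv hκ
  have hC : 1 ≤ C := by linarith [Nat.cast_nonneg (α := ℝ) k]
  refine ⟨C, hC, fun R hR => ?_⟩
  obtain ⟨X, hX, rfl⟩ := exists_pow_sq_eq hR (d + 1)
  obtain ⟨f, hf, hsupp, E, hE, hball, ⟨hvE, hEv⟩, hlow⟩ := hdatum X hX _ rfl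
  have hX0 : 0 < X := zero_lt_one.trans hX
  have hW0 : 0 < X ^ (d + 1 + 1) := pow_pos hX0 _
  have hcodim : ((k + 1 : ℕ) : ℝ) - (d + 1 : ℕ) = (k - d : ℕ) := by push_cast [hd]; ring
  rw [hcodim, sq_rpow_neg_natCast_div_two hW0.le, sq_rpow_neg_three_div_two hW0.le,
    sq_rpow_natCast_div_four hW0.le, pow_sq_rpow_div hX0.le (d + 1)]
  refine ⟨f, hf, hsupp.mono fun ξ h hξ => h fun hmem => hξ ⟨?_, ?_⟩, E, hE, hball,
    le_trans (by gcongr) hvE, hEv.trans (le_mul_of_one_le_left (by positivity) hC),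
    fun x hx => ?_⟩
  · exact (mul_le_of_le_one_left (by positivity) (inv_le_one_of_one_le₀ hC)).trans hmem.1
  · exact hmem.2.trans (by gcongr)
  · obtain ⟨t, ht, hlarge⟩ := hlow x hx
    exact ⟨t, ht.trans (le_mul_of_one_le_left (by positivity) hC), le_trans (by gcongr) hlarge⟩
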